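/- Conventions. A compact quantum group is given by its full Woronowicz Hopf C*-algebra: a unital C*-algebra $A$ with a unital *-homomorphism $\Phi:A\to A\otimes A$ (minimal C*-tensor product) that restricts to the comultiplication of a dense Hopf *-subalgebra $\mathcal A\subseteq A$, where $A$ is the enveloping C*-algebra of $\mathcal A$. It is of Kac type if the antipode $\kappa$ of $\mathcal A$ satisfies $\kappa^2=\mathrm{id}$. An action of $A$ on a unital C*-algebra $B$ is a unital *-homomorphism $\alpha:B\to B\otimes A$ such that $(\mathrm{id}\otimes\Phi)\alpha=(\alpha\otimes\mathrm{id})\alpha$, $(\mathrm{id}\otimes\epsilon)\alpha=\mathrm{id}$ ($\epsilon$ the counit), and $\alpha$ restricts to a right coaction of $\mathcal A$ on some dense *-subalgebra of $B$; $(A,\alpha)$ is then called a compact quantum transformation group of $B$. A morphism from $(\tilde A,\tilde\alpha)$ to $(A,\alpha)$ is a unital *-homomorphism $\pi:A\to\tilde A$ with $(\pi\otimes\pi)\Phi=\tilde\Phi\pi$ and $\tilde\alpha=(\mathrm{id}\otimes\pi)\alpha$. The quantum automorphism group of $B$ in a category of quantum transformation groups of $B$ is a final object of that category. Theorem. Let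 $X_n=\{x_1,\dots,x_n\}$, let $B=C(X_n)$ with minimal projections $e_1,\dots,e_n$, and let $A$ be the universal unital C*-algebra with generators $a_{ij}$ ($i,j=1,\dots,n$) and relations $$a_{ij}^2=a_{ij}=a_{ij}^*,\qquad \sum_{j=1}^n a_{ij}=1\ (i=1,\dots,n),\qquad \sum_{i=1}^n a_{ij}=1\ (j=1,\dots,n).$$ (1) $A$ is a compact quantum group of Kac type, with comultiplication $\Phi(a_{ij})=\sum_{k=1}^n a_{ik}\otimes a_{kj}$ and with dense Hopf *-subalgebra the *-subalgebra generated by the $a_{ij}$. (2) The formulas $\alpha(e_j)=\sum_{i=1}^n e_i\otimes a_{ij}$ ($j=1,\dots,n$) define an action of $A$ on $B$, and $(A,\alpha)$ is the quantum automorphism group of $B$ in the category of all compact quantum transformation groups of $B$, and also in the full subcategory of those of Kac type. Moreover, the set of matrices $\{(\chi(a_{ij}))_{i,j} : \chi:A\to\mathbb C \text{ a unital *-homomorphism}\}$ is precisely the set of $n\times n$ permutation matrices, and $A$ contains the ordinary automorphism group $\mathrm{Aut}(X_n)=S_n$: sending $\sigma\in S_n$ to the character $\chi_\sigma$ with $\chi_\sigma(a_{ij})=1$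 if $\sigma(j)=i$ and $0$ otherwise is a bijection from $S_n$ onto the characters of $A$ that carries the product of $S_n$ to the convolution product $(\chi\otimes\psi)\Phi$. -/

import Mathlib

open scoped TensorProduct InnerProductSpace

universe u

noncomputable section

/-! ### C*-seminorms and Hausdorff completions -/

/-- A C*-seminorm on a complex *-algebra. -/
structure CStarSeminorm (R : Type u) [Ring R] [StarRing R] [Algebra ℂ R] extends
    Seminorm ℂ R where
  map_mul_le' : ∀ x y, toFun (x * y) ≤ toFun x * toFun y
  map_star_mul_self' : ∀ x, toFun (star x * x) = toFun x * toFun x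

namespace CStarSeminorm

variable {R : Type u} [Ring R] [StarRing R] [Algebra ℂ R]

instance : CoeFun (CStarSeminorm R) (fun _ => R → ℝ) := ⟨fun p => p.toSeminorm⟩

theorem map_mul_le (p : CStarSeminorm R) (x y : R) : p (x * y) ≤ p x * p y :=
  p.map_mul_le' x y

theorem map_star_mul_self (p : CStarSeminorm R) (x : R) : p (star x * x) = p x * p x :=
  p.map_star_mul_self' x

theorem le_map_star (p : CStarSeminorm R) (x : R) : p x ≤ p (star x) := by
  rcases (apply_nonneg p.toSeminorm x).eq_or_lt with h | h
  · rw [← h]; exact apply_nonneg p.toSeminorm _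
  · have h1 := p.map_mul_le (star x) x
    rw [p.map_star_mul_self] at h1
    exact le_of_mul_le_mul_right h1 h

theorem map_star (p : CStarSeminorm R) (x : R) : p (star x) = p x :=
  le_antisymm (by simpa using p.le_map_star (star x)) (p.le_map_star x)

/-- The pointwise supremum of a pointwise bounded set of C*-seminorms. -/
def sup (S : Set (CStarSeminorm R)) (hS : ∀ x, BddAbove {r : ℝ | ∃ p ∈ S, r = p x}) :
    CStarSeminorm R where
  toFun x := sSup {r : ℝ | ∃ p ∈ S, r = p x}
  map_zero' := by
    apply le_antisymm
    · apply Real.sSup_le _ le_rfl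
      rintro r ⟨p, -, rfl⟩
      simp
    · apply Real.sSup_nonneg
      rintro r ⟨p, -, rfl⟩
      simp
  add_le' x y := by
    have h0 : ∀ x, 0 ≤ sSup {r : ℝ | ∃ p ∈ S, r = p x} := fun x => by
      apply Real.sSup_nonneg
      rintro r ⟨p, -, rfl⟩
      exact apply_nonneg p.toSeminorm x
    apply Real.sSup_le _ (add_nonneg (h0 x) (h0 y))
    rintro r ⟨p, hp, rfl⟩
    exact (map_add_le_add p.toSeminorm x y).trans
      (add_le_add (le_csSup (hS x) ⟨p, hp, rfl⟩) (le_csSup (hS y) ⟨p, hp, rfl⟩))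
  neg' x := by simp
  smul' a x := by
    have h : {r : ℝ | ∃ p ∈ S, r = p (a • x)} =
        (fun r => ‖a‖ * r) '' {r : ℝ | ∃ p ∈ S, r = p x} := by
      ext r
      simp only [Set.mem_image, Set.mem_ofPred_eq, map_smul_eq_mul]
      constructor
      · rintro ⟨p, hp, rfl⟩; exact ⟨_, ⟨p, hp, rfl⟩, rfl⟩
      · rintro ⟨_, ⟨p, hp, rfl⟩, rfl⟩; exact ⟨p, hp, rfl⟩
    rw [h]
    exact Real.sSup_smul_of_nonneg (norm_nonneg a) _
  map_mul_le' x y := by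
    have h0 : ∀ x, 0 ≤ sSup {r : ℝ | ∃ p ∈ S, r = p x} := fun x => by
      apply Real.sSup_nonneg
      rintro r ⟨p, -, rfl⟩
      exact apply_nonneg p.toSeminorm x
    apply Real.sSup_le _ (mul_nonneg (h0 x) (h0 y))
    rintro r ⟨p, hp, rfl⟩
    exact (p.map_mul_le x y).trans (mul_le_mul (le_csSup (hS x) ⟨p, hp, rfl⟩)
      (le_csSup (hS y) ⟨p, hp, rfl⟩) (apply_nonneg p.toSeminorm y) (h0 x))
  map_star_mul_self' x := by
    have h0 : ∀ x, 0 ≤ sSup {r : ℝ | ∃ p ∈ S, r = p x} := fun x => by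
      apply Real.sSup_nonneg
      rintro r ⟨p, -, rfl⟩
      exact apply_nonneg p.toSeminorm x
    apply le_antisymm
    · apply Real.sSup_le _ (mul_nonneg (h0 x) (h0 x))
      rintro r ⟨p, hp, rfl⟩
      rw [p.map_star_mul_self]
      have := le_csSup (hS x) ⟨p, hp, rfl⟩
      exact mul_self_le_mul_self (apply_nonneg p.toSeminorm x) this
    · have h : sSup {r : ℝ | ∃ p ∈ S, r = p x} ≤
          √(sSup {r : ℝ | ∃ p ∈ S, r = p (star x * x)}) := by
        apply Real.sSup_le _ (Real.sqrt_nonneg _)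
        rintro r ⟨p, hp, rfl⟩
        apply Real.le_sqrt_of_sq_le
        rw [sq, ← p.map_star_mul_self]
        exact le_csSup (hS _) ⟨p, hp, rfl⟩
      calc _ ≤ _ := mul_self_le_mul_self (h0 x) h
        _ = _ := Real.mul_self_sqrt (h0 _)

/-- The C*-seminorm `x ↦ ‖f x‖` defined by a *-homomorphism `f` into a C*-algebra. -/
def ofHom {D : Type*} [CStarAlgebra D] (f : R →⋆ₐ[ℂ] D) : CStarSeminorm R where
  toFun x := ‖f x‖
  map_zero' := by rw [map_zero, norm_zero]
  add_le' x y := by rw [map_add]; exact norm_add_le _ _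
  neg' x := by rw [map_neg, norm_neg]
  smul' c x := by rw [map_smul, norm_smul]
  map_mul_le' x y := by rw [map_mul]; exact norm_mul_le _ _
  map_star_mul_self' x := by
    rw [map_mul, StarHomClass.map_star, CStarRing.norm_star_mul_self]

/-- The *-algebra `R`, regarded as a seminormed *-algebra through `p`. -/
def Pre (_p : CStarSeminorm R) : Type u := R

variable (p : CStarSeminorm R)

instance : Ring p.Pre := inferInstanceAs (Ring R)
instance : StarRing p.Pre := inferInstanceAs (StarRing R)
instance : Algebra ℂ p.Pre := inferInstanceAs (Algebra ℂ R)

instance : SeminormedRing p.Pre :=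
  { (inferInstance : Ring p.Pre),
    p.toSeminorm.toAddGroupSeminorm.toSeminormedAddCommGroup with
    norm_mul_le := p.map_mul_le }

instance : NormedSpace ℂ p.Pre where
  norm_smul_le a x := (map_smul_eq_mul p.toSeminorm a (show R from x)).le

instance : NormedStarGroup p.Pre where
  norm_star_le x := (p.map_star (show R from x)).le

/-- The Hausdorff completion of a *-algebra with respect to a C*-seminorm. -/
def Completion : Type u := UniformSpace.Completion p.Pre

instance : NormedRing p.Completion := inferInstanceAs (NormedRing (UniformSpace.Completion p.Pre))
instance : CompleteSpace p.Completion :=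
  inferInstanceAs (CompleteSpace (UniformSpace.Completion p.Pre))
instance : Algebra ℂ p.Completion := inferInstanceAs (Algebra ℂ (UniformSpace.Completion p.Pre))

instance : NormedAlgebra ℂ p.Completion where
  norm_smul_le := norm_smul_le (α := ℂ) (β := UniformSpace.Completion p.Pre)

/-- The canonical map from `R` to its completion. -/
def incl (x : R) : p.Completion := ((show p.Pre from x : p.Pre) : UniformSpace.Completion p.Pre)

theorem denseRange_incl : DenseRange p.incl :=
  UniformSpace.Completion.denseRange_coe (α := p.Pre)

theorem induction_on {P : p.Completion → Prop} (x : p.Completion) (hp : IsClosed {x | P x})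
    (ih : ∀ x : R, P (p.incl x)) : P x :=
  UniformSpace.Completion.induction_on x hp ih

theorem uniformContinuous_star : UniformContinuous (star : p.Pre → p.Pre) :=
  (starNormedAddGroupHom : NormedAddGroupHom p.Pre p.Pre).uniformContinuous

instance : Star p.Completion := ⟨UniformSpace.Completion.map (star : p.Pre → p.Pre)⟩

theorem continuous_star' : Continuous (star : p.Completion → p.Completion) :=
  UniformSpace.Completion.continuous_map

theorem star_incl (x : R) : star (p.incl x) = p.incl (star x) :=
  UniformSpace.Completion.map_coe p.uniformContinuous_star _

theorem mul_incl (x y : R) : p.incl x * p.incl y = p.incl (x * y) :=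
  (UniformSpace.Completion.coe_mul (α := p.Pre) _ _).symm

theorem add_incl (x y : R) : p.incl x + p.incl y = p.incl (x + y) :=
  (UniformSpace.Completion.coe_add (α := p.Pre) _ _).symm

theorem smul_incl (c : ℂ) (x : R) : c • p.incl x = p.incl (c • x) :=
  (UniformSpace.Completion.coe_smul c (show p.Pre from x)).symm

theorem norm_incl (x : R) : ‖p.incl x‖ = p x :=
  UniformSpace.Completion.norm_coe (show p.Pre from x)

instance : StarRing p.Completion where
  star_involutive x := by
    induction x using p.induction_on with
    | hp => exact isClosed_eq (p.continuous_star'.comp p.continuous_star') continuous_id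
    | ih x => rw [star_incl, star_incl, star_star]
  star_mul x y := by
    induction x using p.induction_on with
    | hp => exact isClosed_eq (p.continuous_star'.comp (continuous_mul_const y))
              ((continuous_const_mul (star y)).comp p.continuous_star')
    | ih x =>
      induction y using p.induction_on with
      | hp => exact isClosed_eq (p.continuous_star'.comp (continuous_const_mul _))
                ((continuous_mul_const _).comp p.continuous_star')
      | ih y => simp only [star_incl, mul_incl, star_mul]
  star_add x y := by
    induction x using p.induction_on with
    | hp => exact isClosed_eq (p.continuous_star'.comp (continuous_add_const y))
              ((continuous_add_const (star y)).comp p.continuous_star')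
    | ih x =>
      induction y using p.induction_on with
      | hp => exact isClosed_eq (p.continuous_star'.comp (continuous_const_add _))
                ((continuous_const_add _).comp p.continuous_star')
      | ih y => simp only [star_incl, add_incl, star_add]

instance [StarModule ℂ R] : CStarAlgebra p.Completion where
  norm_mul_self_le x := by
    induction x using p.induction_on with
    | hp => exact isClosed_le (continuous_norm.mul continuous_norm)
              (continuous_norm.comp (p.continuous_star'.mul continuous_id))
    | ih x =>
      rw [star_incl, mul_incl, norm_incl, norm_incl]
      exact (p.map_star_mul_self x).ge
  star_smul c x := by
    induction x using p.induction_on with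
    | hp => exact isClosed_eq (p.continuous_star'.comp (continuous_const_smul c))
              ((continuous_const_smul (star c)).comp p.continuous_star')
    | ih x => simp only [star_incl, smul_incl, star_smul]

variable [StarModule ℂ R]

/-- The canonical *-homomorphism from `R` to its completion. -/
def of : R →⋆ₐ[ℂ] p.Completion where
  toFun := p.incl
  map_one' := rfl
  map_mul' x y := (p.mul_incl x y).symm
  map_zero' := rfl
  map_add' x y := (p.add_incl x y).symm
  commutes' _ := rfl
  map_star' x := (p.star_incl x).symm

theorem exists_lift {D : Type*} [CStarAlgebra D] (f : R →⋆ₐ[ℂ] D) (hf : ∀ x, ‖f x‖ ≤ p x) :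
    ∃ g : p.Completion →⋆ₐ[ℂ] D, ∀ x, g (p.of x) = f x := by
  let f' : p.Pre →+ D := (f.toAlgHom : R →+ D)
  have hu : UniformContinuous f' :=
    AddMonoidHomClass.uniformContinuous_of_bound f' 1 (fun x => by rw [one_mul]; exact hf x)
  let g : p.Completion → D := UniformSpace.Completion.extension f'
  have hc : Continuous g := UniformSpace.Completion.continuous_extension
  have he : ∀ x : R, g (p.incl x) = f x := fun x =>
    UniformSpace.Completion.extension_coe hu (show p.Pre from x)
  refine ⟨{ toFun := g, map_one' := (he 1).trans (map_one f), map_mul' := fun x y => ?_,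
            map_zero' := (he 0).trans (map_zero f), map_add' := fun x y => ?_,
            commutes' := fun c => (he (algebraMap ℂ R c)).trans (AlgHomClass.commutes f c),
            map_star' := fun x => ?_ }, he⟩
  · induction x using p.induction_on with
    | hp => exact isClosed_eq (hc.comp (continuous_mul_const y)) (hc.mul continuous_const)
    | ih x =>
      induction y using p.induction_on with
      | hp => exact isClosed_eq (hc.comp (continuous_const_mul _)) (continuous_const.mul hc)
      | ih y => rw [mul_incl, he, he, he, map_mul]
  · change g (x + y) = g x + g y
    induction x using p.induction_on with
    | hp => exact isClosed_eq (hc.comp (continuous_add_const y)) (hc.add continuous_const)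
    | ih x =>
      induction y using p.induction_on with
      | hp => exact isClosed_eq (hc.comp (continuous_const_add _)) (continuous_const.add hc)
      | ih y => rw [add_incl, he, he, he, map_add]
  · induction x using p.induction_on with
    | hp => exact isClosed_eq (hc.comp p.continuous_star') ((ContinuousStar.continuous_star (R := D)).comp hc)
    | ih x => rw [star_incl, he, he, StarHomClass.map_star]

/-- A *-homomorphism dominated by the C*-seminorm `p` extends to the completion. -/
def lift {D : Type*} [CStarAlgebra D] (f : R →⋆ₐ[ℂ] D) (hf : ∀ x, ‖f x‖ ≤ p x) :
    p.Completion →⋆ₐ[ℂ] D :=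
  (p.exists_lift f hf).choose

theorem lift_of {D : Type*} [CStarAlgebra D] (f : R →⋆ₐ[ℂ] D) (hf : ∀ x, ‖f x‖ ≤ p x) (x : R) :
    p.lift f hf (p.of x) = f x :=
  (p.exists_lift f hf).choose_spec x

end CStarSeminorm

/-! ### The minimal C*-tensor product -/

section HilbertTensor

/-- The Hilbert space tensor product. -/
def HilbertTensor (H K : Type u) [NormedAddCommGroup H] [InnerProductSpace ℂ H]
    [NormedAddCommGroup K] [InnerProductSpace ℂ K] : Type u :=
  UniformSpace.Completion (H ⊗[ℂ] K)

variable {H K : Type u} [NormedAddCommGroup H] [InnerProductSpace ℂ H]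
  [NormedAddCommGroup K] [InnerProductSpace ℂ K]

instance : NormedAddCommGroup (HilbertTensor H K) :=
  inferInstanceAs (NormedAddCommGroup (UniformSpace.Completion (H ⊗[ℂ] K)))
instance : InnerProductSpace ℂ (HilbertTensor H K) :=
  inferInstanceAs (InnerProductSpace ℂ (UniformSpace.Completion (H ⊗[ℂ] K)))
instance : CompleteSpace (HilbertTensor H K) :=
  inferInstanceAs (CompleteSpace (UniformSpace.Completion (H ⊗[ℂ] K)))

/-- The isometric inclusion of the algebraic into the Hilbert space tensor product. -/
def HilbertTensor.of : H ⊗[ℂ] K →ₗᵢ[ℂ] HilbertTensor H K :=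
  UniformSpace.Completion.toComplₗᵢ

theorem HilbertTensor.induction_on {P : HilbertTensor H K → Prop} (x : HilbertTensor H K)
    (hp : IsClosed {x | P x}) (ih : ∀ x : H ⊗[ℂ] K, P (HilbertTensor.of x)) : P x :=
  UniformSpace.Completion.induction_on x hp ih

/-- The tensor product `S ⊗ T` of bounded operators on the Hilbert space tensor product. -/
def opTensor (S : H →L[ℂ] H) (T : K →L[ℂ] K) : HilbertTensor H K →L[ℂ] HilbertTensor H K :=
  (TensorProduct.mapL S T).completion

theorem opTensor_of (S : H →L[ℂ] H) (T : K →L[ℂ] K) (x : H ⊗[ℂ] K) :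
    opTensor S T (HilbertTensor.of x) =
      HilbertTensor.of (TensorProduct.map S.toLinearMap T.toLinearMap x) :=
  (ContinuousLinearMap.completion_apply_coe (TensorProduct.mapL S T) x).trans
    (congrArg HilbertTensor.of (TensorProduct.mapL_apply S T x))

theorem op_ext {S T : HilbertTensor H K →L[ℂ] HilbertTensor H K}
    (h : ∀ ξ η, S (HilbertTensor.of (ξ ⊗ₜ[ℂ] η)) = T (HilbertTensor.of (ξ ⊗ₜ[ℂ] η))) : S = T := by
  ext x
  induction x using HilbertTensor.induction_on with
  | hp => exact isClosed_eq S.continuous T.continuous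
  | ih x =>
    induction x with
    | zero => rw [map_zero, map_zero, map_zero]
    | add x y hx hy => rw [map_add, map_add, map_add, hx, hy]
    | tmul ξ η => exact h ξ η

theorem opTensor_mul (S S' : H →L[ℂ] H) (T T' : K →L[ℂ] K) :
    opTensor (S * S') (T * T') = opTensor S T * opTensor S' T' := by
  refine op_ext fun ξ η => ?_
  change _ = opTensor S T (opTensor S' T' _)
  rw [opTensor_of, opTensor_of, opTensor_of]
  rfl

theorem opTensor_one : opTensor (1 : H →L[ℂ] H) (1 : K →L[ℂ] K) = 1 := by
  refine op_ext fun ξ η => ?_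
  rw [opTensor_of]
  rfl

theorem opTensor_star [CompleteSpace H] [CompleteSpace K] (S : H →L[ℂ] H) (T : K →L[ℂ] K) :
    opTensor (star S) (star T) = star (opTensor S T) := by
  rw [ContinuousLinearMap.star_eq_adjoint (opTensor S T), ContinuousLinearMap.eq_adjoint_iff]
  intro x y
  induction x using HilbertTensor.induction_on with
  | hp => exact isClosed_eq ((opTensor _ _).continuous.inner continuous_const)
            (continuous_id.inner continuous_const)
  | ih x =>
    induction y using HilbertTensor.induction_on with
    | hp => exact isClosed_eq (continuous_const.inner continuous_id)
              (continuous_const.inner (opTensor _ _).continuous)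
    | ih y =>
      rw [opTensor_of, opTensor_of, LinearIsometry.inner_map_map, LinearIsometry.inner_map_map]
      induction x with
      | zero => simp
      | add x x' hx hy => simp only [map_add, inner_add_left, hx, hy]
      | tmul ξ₁ ξ₂ =>
        induction y with
        | zero => simp
        | add x y hx hy => simp only [map_add, inner_add_right, hx, hy]
        | tmul η₁ η₂ =>
          simp [ContinuousLinearMap.star_eq_adjoint, ContinuousLinearMap.adjoint_inner_left]

theorem norm_opTensor_le (S : H →L[ℂ] H) (T : K →L[ℂ] K) : ‖opTensor S T‖ ≤ ‖S‖ * ‖T‖ := by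
  refine ContinuousLinearMap.opNorm_le_bound _ (by positivity) fun x => ?_
  induction x using HilbertTensor.induction_on with
  | hp => exact isClosed_le (continuous_norm.comp (opTensor S T).continuous)
            (continuous_const.mul continuous_norm)
  | ih x =>
    rw [opTensor_of, LinearIsometry.norm_map, LinearIsometry.norm_map, ← TensorProduct.mapL_apply]
    exact ContinuousLinearMap.le_of_opNorm_le _ (TensorProduct.norm_mapL_le S T) x

/-- `opTensor` as a bilinear map. -/
def opTensorₗ : (H →L[ℂ] H) →ₗ[ℂ] (K →L[ℂ] K) →ₗ[ℂ] (HilbertTensor H K →L[ℂ] HilbertTensor H K) :=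
  LinearMap.mk₂ ℂ opTensor
    (fun S S' T => op_ext fun ξ η => by
      change _ = opTensor S T _ + opTensor S' T _
      rw [opTensor_of, opTensor_of, opTensor_of, ← map_add]
      simp [TensorProduct.add_tmul])
    (fun c S T => op_ext fun ξ η => by
      change _ = c • opTensor S T _
      rw [opTensor_of, opTensor_of, ← map_smul]
      simp [TensorProduct.smul_tmul'])
    (fun S T T' => op_ext fun ξ η => by
      change _ = opTensor S T _ + opTensor S T' _
      rw [opTensor_of, opTensor_of, opTensor_of, ← map_add]
      simp [TensorProduct.tmul_add])
    (fun c S T => op_ext fun ξ η => by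
      change _ = c • opTensor S T _
      rw [opTensor_of, opTensor_of, ← map_smul]
      simp [TensorProduct.tmul_smul])

end HilbertTensor

section MinTensor

variable {A B H K : Type u} [CStarAlgebra A] [CStarAlgebra B]
  [NormedAddCommGroup H] [InnerProductSpace ℂ H] [CompleteSpace H]
  [NormedAddCommGroup K] [InnerProductSpace ℂ K] [CompleteSpace K]

/-- For representations `π` of `A` on `H` and `ρ` of `B` on `K`, the representation `π ⊗ ρ` of the
algebraic tensor product `A ⊗ B` on the Hilbert space tensor product of `H` and `K`. -/
def repTensor (π : A →⋆ₐ[ℂ] (H →L[ℂ] H)) (ρ : B →⋆ₐ[ℂ] (K →L[ℂ] K)) :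
    A ⊗[ℂ] B →⋆ₐ[ℂ] (HilbertTensor H K →L[ℂ] HilbertTensor H K) :=
  let φ : A ⊗[ℂ] B →ₐ[ℂ] (HilbertTensor H K →L[ℂ] HilbertTensor H K) :=
    Algebra.TensorProduct.algHomOfLinearMapTensorProduct
      (TensorProduct.lift
        (opTensorₗ.compl₁₂ π.toAlgHom.toLinearMap ρ.toAlgHom.toLinearMap))
      (fun a a' b b' => by
        change opTensor (π (a * a')) (ρ (b * b')) = opTensor (π a) (ρ b) * opTensor (π a') (ρ b')
        rw [map_mul, map_mul, opTensor_mul])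
      (by
        change opTensor (π 1) (ρ 1) = 1
        rw [map_one, map_one, opTensor_one])
  { φ with
    map_star' := fun x => by
      change φ (star x) = star (φ x)
      induction x with
      | zero => rw [star_zero, map_zero, star_zero]
      | add x y hx hy => rw [star_add, map_add, map_add, star_add, hx, hy]
      | tmul a b =>
        change opTensor (π (star a)) (ρ (star b)) = star (opTensor (π a) (ρ b))
        rw [StarHomClass.map_star, StarHomClass.map_star, opTensor_star] }

theorem repTensor_tmul (π : A →⋆ₐ[ℂ] (H →L[ℂ] H)) (ρ : B →⋆ₐ[ℂ] (K →L[ℂ] K)) (a : A) (b : B) :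
    repTensor π ρ (a ⊗ₜ b) = opTensor (π a) (ρ b) := rfl

end MinTensor

section MinTensor

variable (A B : Type u) [CStarAlgebra A] [CStarAlgebra B]

/-- The set of all C*-seminorms on `A ⊗ B` that come from a pair of Hilbert space representations
of `A` and of `B`. -/
def spatialSeminorms : Set (CStarSeminorm (A ⊗[ℂ] B)) :=
  {p | ∃ (H K : Type u) (_ : NormedAddCommGroup H) (_ : InnerProductSpace ℂ H)
    (_ : CompleteSpace H) (_ : NormedAddCommGroup K) (_ : InnerProductSpace ℂ K)
    (_ : CompleteSpace K) (π : A →⋆ₐ[ℂ] (H →L[ℂ] H)) (ρ : B →⋆ₐ[ℂ] (K →L[ℂ] K)),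
    p = CStarSeminorm.ofHom (repTensor π ρ)}

theorem spatialSeminorms_bddAbove (x : A ⊗[ℂ] B) :
    BddAbove {r : ℝ | ∃ p ∈ spatialSeminorms A B, r = p x} := by
  suffices h : ∃ C, ∀ p ∈ spatialSeminorms A B, p x ≤ C by
    obtain ⟨C, hC⟩ := h
    exact ⟨C, by rintro r ⟨p, hp, rfl⟩; exact hC p hp⟩
  induction x with
  | zero => exact ⟨0, fun p _ => by simp⟩
  | add x y hx hy =>
    obtain ⟨C, hC⟩ := hx
    obtain ⟨D, hD⟩ := hy
    exact ⟨C + D, fun p hp => (map_add_le_add p.toSeminorm x y).trans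
      (add_le_add (hC p hp) (hD p hp))⟩
  | tmul a b =>
    refine ⟨‖a‖ * ‖b‖, ?_⟩
    rintro p ⟨H, K, _, _, _, _, _, _, π, ρ, rfl⟩
    refine (norm_opTensor_le (π a) (ρ b)).trans (mul_le_mul (NonUnitalStarAlgHom.norm_apply_le π a)
      (NonUnitalStarAlgHom.norm_apply_le ρ b) (norm_nonneg _) (norm_nonneg _))

/-- The minimal (spatial) C*-norm on the algebraic tensor product:
`‖x‖ = sup ‖(π ⊗ ρ)(x)‖` over all representations `π` of `A` and `ρ` of `B`. -/
def minSeminorm : CStarSeminorm (A ⊗[ℂ] B) :=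
  CStarSeminorm.sup (spatialSeminorms A B) (spatialSeminorms_bddAbove A B)

/-- The minimal (spatial) C*-tensor product of two unital C*-algebras. -/
abbrev MinTensor : Type u := (minSeminorm A B).Completion

infixl:100 " ⊗ₘ " => MinTensor

end MinTensor

namespace MinTensor

variable {A B C D : Type u} [CStarAlgebra A] [CStarAlgebra B] [CStarAlgebra C] [CStarAlgebra D]

/-- The canonical map from the algebraic to the minimal C*-tensor product. -/
def of : A ⊗[ℂ] B →⋆ₐ[ℂ] A ⊗ₘ B := (minSeminorm A B).of

/-- The elementary tensor `a ⊗ b`. -/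
def tmul (a : A) (b : B) : A ⊗ₘ B := of (a ⊗ₜ[ℂ] b)

/-- The algebraic tensor product of two *-homomorphisms. -/
def algMap (f : A →⋆ₐ[ℂ] C) (g : B →⋆ₐ[ℂ] D) : A ⊗[ℂ] B →⋆ₐ[ℂ] C ⊗[ℂ] D :=
  { Algebra.TensorProduct.map f.toAlgHom g.toAlgHom with
    map_star' := fun x => by
      change Algebra.TensorProduct.map f.toAlgHom g.toAlgHom (star x) =
        star (Algebra.TensorProduct.map f.toAlgHom g.toAlgHom x)
      induction x with
      | zero => simp
      | add x y hx hy => simp only [star_add, map_add, hx, hy]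
      | tmul a b => simp [map_star] }

theorem repTensor_algMap {H K : Type u} [NormedAddCommGroup H] [InnerProductSpace ℂ H]
    [CompleteSpace H] [NormedAddCommGroup K] [InnerProductSpace ℂ K] [CompleteSpace K]
    (π : C →⋆ₐ[ℂ] (H →L[ℂ] H)) (ρ : D →⋆ₐ[ℂ] (K →L[ℂ] K)) (f : A →⋆ₐ[ℂ] C) (g : B →⋆ₐ[ℂ] D)
    (x : A ⊗[ℂ] B) : repTensor π ρ (algMap f g x) = repTensor (π.comp f) (ρ.comp g) x := by
  induction x with
  | zero => simp
  | add x y hx hy => simp only [map_add, hx, hy]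
  | tmul a b =>
    change repTensor π ρ (f a ⊗ₜ g b) = _
    rw [repTensor_tmul, repTensor_tmul]
    rfl

theorem minSeminorm_algMap_le (f : A →⋆ₐ[ℂ] C) (g : B →⋆ₐ[ℂ] D) (x : A ⊗[ℂ] B) :
    minSeminorm C D (algMap f g x) ≤ minSeminorm A B x := by
  refine Real.sSup_le ?_ (apply_nonneg (minSeminorm A B).toSeminorm x)
  rintro r ⟨p, ⟨H, K, _, _, _, _, _, _, π, ρ, rfl⟩, rfl⟩
  refine le_csSup (spatialSeminorms_bddAbove A B x)
    ⟨CStarSeminorm.ofHom (repTensor (π.comp f) (ρ.comp g)), ⟨H, K, _, _, _, _, _, _, _, _, rfl⟩, ?_⟩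
  exact congrArg norm (repTensor_algMap π ρ f g x)

/-- The tensor product `f ⊗ g` of two unital *-homomorphisms. -/
def map (f : A →⋆ₐ[ℂ] C) (g : B →⋆ₐ[ℂ] D) : A ⊗ₘ B →⋆ₐ[ℂ] C ⊗ₘ D :=
  (minSeminorm A B).lift (of.comp (algMap f g)) fun x =>
    ((minSeminorm C D).norm_incl _).trans_le (minSeminorm_algMap_le f g x)

theorem map_tmul (f : A →⋆ₐ[ℂ] C) (g : B →⋆ₐ[ℂ] D) (a : A) (b : B) :
    map f g (tmul a b) = tmul (f a) (g b) :=
  (minSeminorm A B).lift_of _ _ _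

/-- The map `𝒜 ⊗ ℬ → A ⊗ B` from the algebraic tensor product of *-subalgebras `𝒜 ⊆ A` and
`ℬ ⊆ B` to the minimal C*-tensor product. -/
def ofSub (𝒜 : StarSubalgebra ℂ A) (ℬ : StarSubalgebra ℂ B) : 𝒜 ⊗[ℂ] ℬ →ₗ[ℂ] A ⊗ₘ B :=
  of.toAlgHom.toLinearMap ∘ₗ
    TensorProduct.map 𝒜.subtype.toAlgHom.toLinearMap ℬ.subtype.toAlgHom.toLinearMap

end MinTensor

/-! ### Compact quantum groups -/

/-- A Hopf *-algebra structure on a unital complex *-algebra. -/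
structure HopfStarStructure (𝒜 : Type u) [Ring 𝒜] [StarRing 𝒜] [Algebra ℂ 𝒜]
    [StarModule ℂ 𝒜] where
  comul : 𝒜 →⋆ₐ[ℂ] 𝒜 ⊗[ℂ] 𝒜
  counit : 𝒜 →⋆ₐ[ℂ] ℂ
  antipode : 𝒜 →ₗ[ℂ] 𝒜
  coassoc : ∀ a, TensorProduct.assoc ℂ 𝒜 𝒜 𝒜
      (comul.toAlgHom.toLinearMap.rTensor 𝒜 (comul a)) =
    comul.toAlgHom.toLinearMap.lTensor 𝒜 (comul a)
  counit_left : ∀ a, counit.toAlgHom.toLinearMap.rTensor 𝒜 (comul a) = 1 ⊗ₜ[ℂ] a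
  counit_right : ∀ a, counit.toAlgHom.toLinearMap.lTensor 𝒜 (comul a) = a ⊗ₜ[ℂ] 1
  antipode_left : ∀ a, LinearMap.mul' ℂ 𝒜 (antipode.rTensor 𝒜 (comul a)) =
    algebraMap ℂ 𝒜 (counit a)
  antipode_right : ∀ a, LinearMap.mul' ℂ 𝒜 (antipode.lTensor 𝒜 (comul a)) =
    algebraMap ℂ 𝒜 (counit a)

/-- A compact quantum group, given by its full Woronowicz Hopf C*-algebra `A`: a unital C*-algebra
with a unital *-homomorphism `comul : A → A ⊗ₘ A` that restricts to the comultiplication of a dense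
Hopf *-subalgebra `core`. (The dense Hopf *-subalgebra is unique: it is the linear span of the
coefficients of the finite dimensional representations.)
`A` is full when its norm is the largest C*-seminorm on `core`, that is, when `A` is the enveloping
C*-algebra of `core`. Coassociativity of `comul` on all of `A` follows from the one on `core` by
density, and the counit and its identities extend to `A` by fullness. -/
structure CompactQuantumGroup (A : Type u) [CStarAlgebra A] where
  comul : A →⋆ₐ[ℂ] A ⊗ₘ A
  core : StarSubalgebra ℂ A
  dense_core : Dense (core : Set A)
  hopf : HopfStarStructure core
  comul_core : ∀ a : core, comul (a : A) = MinTensor.ofSub core core (hopf.comul a)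
  full : ∀ (p : CStarSeminorm core) (a : core), p a ≤ ‖(a : A)‖

namespace CompactQuantumGroup

variable {A B : Type u} [CStarAlgebra A] [CStarAlgebra B]

/-- A compact quantum group is of Kac type when its antipode is involutive. -/
def IsKac (G : CompactQuantumGroup A) : Prop :=
  ∀ a, G.hopf.antipode (G.hopf.antipode a) = a

/-- `α : B → B ⊗ₘ A` is an action of the compact quantum group on `B`: there is a dense
*-subalgebra `ℬ` of `B` on which `α` restricts to a right coaction `δ : ℬ → ℬ ⊗ core` of the Hopf
*-algebra `core`. By density and continuity, `(id ⊗ comul) α = (α ⊗ id) α` and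
`(id ⊗ counit) α = id` then hold on all of `B`. -/
def IsAction (G : CompactQuantumGroup A) (α : B →⋆ₐ[ℂ] B ⊗ₘ A) : Prop :=
  ∃ (ℬ : StarSubalgebra ℂ B) (δ : ℬ →⋆ₐ[ℂ] ℬ ⊗[ℂ] G.core),
    Dense (ℬ : Set B) ∧
    (∀ b : ℬ, α (b : B) = MinTensor.ofSub ℬ G.core (δ b)) ∧
    (∀ b, TensorProduct.assoc ℂ ℬ G.core G.core
        (δ.toAlgHom.toLinearMap.rTensor G.core (δ b)) =
      G.hopf.comul.toAlgHom.toLinearMap.lTensor ℬ (δ b)) ∧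
    (∀ b, G.hopf.counit.toAlgHom.toLinearMap.lTensor ℬ (δ b) = b ⊗ₜ[ℂ] 1)

/-- `θ` is the convolution product `(χ ⊗ ψ) comul` of the points `χ` and `ψ` of the compact quantum
group, i.e. the product of `χ` and `ψ` in its group of points. -/
def IsConvolution (G : CompactQuantumGroup A) (χ ψ θ : A →⋆ₐ[ℂ] ℂ) : Prop :=
  ∀ a : G.core, θ (a : A) = LinearMap.mul' ℂ ℂ
    (TensorProduct.map (χ.comp G.core.subtype).toAlgHom.toLinearMap
      (ψ.comp G.core.subtype).toAlgHom.toLinearMap (G.hopf.comul a))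

end CompactQuantumGroup

/-- A compact quantum transformation group `(A, α)` of the C*-algebra `B`. -/
structure QuantumTransformationGroup (B : Type u) [CStarAlgebra B] where
  A : Type u
  [cstar : CStarAlgebra A]
  G : CompactQuantumGroup A
  α : B →⋆ₐ[ℂ] B ⊗ₘ A
  isAction : G.IsAction α

namespace QuantumTransformationGroup

variable {B : Type u} [CStarAlgebra B]

instance (T : QuantumTransformationGroup B) : CStarAlgebra T.A := T.cstar

/-- `π : T.A → S.A` is a morphism of quantum transformation groups from `S` to `T`. -/
def IsMorphism (S T : QuantumTransformationGroup B) (π : T.A →⋆ₐ[ℂ] S.A) : Prop :=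
  (∀ a, S.G.comul (π a) = MinTensor.map π π (T.G.comul a)) ∧
    ∀ b, S.α b = MinTensor.map (StarAlgHom.id ℂ B) π (T.α b)

/-- `T` is the quantum automorphism group of `B` in the full subcategory on `𝒞` of the category of
compact quantum transformation groups of `B`: it is a final object of `𝒞`. -/
def IsQuantumAutomorphismGroup (𝒞 : Set (QuantumTransformationGroup B))
    (T : QuantumTransformationGroup B) : Prop :=
  T ∈ 𝒞 ∧ ∀ S ∈ 𝒞, ∃! π : T.A →⋆ₐ[ℂ] S.A, IsMorphism S T π

end QuantumTransformationGroup

/-! ### The universal C*-algebra -/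

/-- The opposite ring with the conjugate complex scalar multiplication. -/
def ConjOpposite (R : Type u) : Type u := Rᵐᵒᵖ

instance (R : Type u) [Ring R] : Ring (ConjOpposite R) := inferInstanceAs (Ring Rᵐᵒᵖ)

instance (R : Type u) [Ring R] [Algebra ℂ R] : Algebra ℂ (ConjOpposite R) :=
  RingHom.toAlgebra' ((algebraMap ℂ Rᵐᵒᵖ).comp (starRingEnd ℂ)) fun c x =>
    Algebra.commutes (A := Rᵐᵒᵖ) (starRingEnd ℂ c) x

/-- The complex unital *-algebra freely generated by self-adjoint elements indexed by `S`. -/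
def FreeStarAlgebra (S : Type u) : Type u := FreeAlgebra ℂ S

namespace FreeStarAlgebra

variable {S : Type u}

instance : Ring (FreeStarAlgebra S) := inferInstanceAs (Ring (FreeAlgebra ℂ S))
instance : Algebra ℂ (FreeStarAlgebra S) := inferInstanceAs (Algebra ℂ (FreeAlgebra ℂ S))

/-- The generators. -/
def X (s : S) : FreeStarAlgebra S := FreeAlgebra.ι ℂ s

/-- The conjugate linear anti-automorphism that fixes the generators. -/
def starHom : FreeStarAlgebra S →ₐ[ℂ] ConjOpposite (FreeStarAlgebra S) :=
  FreeAlgebra.lift ℂ fun s => (MulOpposite.op (X s) : (FreeStarAlgebra S)ᵐᵒᵖ)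

instance : Star (FreeStarAlgebra S) :=
  ⟨fun x => MulOpposite.unop (show (FreeStarAlgebra S)ᵐᵒᵖ from starHom x)⟩

theorem star_X (s : S) : star (X s) = X s :=
  congrArg MulOpposite.unop (FreeAlgebra.lift_ι_apply (A := ConjOpposite (FreeStarAlgebra S)) _ s)

theorem star_algebraMap (c : ℂ) :
    star (algebraMap ℂ (FreeStarAlgebra S) c) = algebraMap ℂ (FreeStarAlgebra S) (star c) :=
  congrArg MulOpposite.unop (starHom.commutes c)

theorem star_mul' (x y : FreeStarAlgebra S) : star (x * y) = star y * star x :=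
  congrArg MulOpposite.unop (map_mul starHom x y)

theorem star_add' (x y : FreeStarAlgebra S) : star (x + y) = star x + star y :=
  congrArg MulOpposite.unop (map_add starHom x y)

theorem induction {P : FreeStarAlgebra S → Prop} (h₀ : ∀ c, P (algebraMap ℂ _ c))
    (h₁ : ∀ s, P (X s)) (h₂ : ∀ x y, P x → P y → P (x * y)) (h₃ : ∀ x y, P x → P y → P (x + y))
    (x : FreeStarAlgebra S) : P x :=
  FreeAlgebra.induction (R := ℂ) (X := S) (motive := P) h₀ h₁ h₂ h₃ x

instance : StarRing (FreeStarAlgebra S) where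
  star_involutive x := by
    induction x using induction with
    | h₀ c => rw [star_algebraMap, star_algebraMap, star_star]
    | h₁ s => rw [star_X, star_X]
    | h₂ x y hx hy => rw [star_mul', star_mul', hx, hy]
    | h₃ x y hx hy => rw [star_add', star_add', hx, hy]
  star_mul := star_mul'
  star_add := star_add'

instance : StarModule ℂ (FreeStarAlgebra S) where
  star_smul c x := by
    rw [Algebra.smul_def, Algebra.smul_def, star_mul', star_algebraMap, Algebra.commutes]

end FreeStarAlgebra

section QuantumPermutation

variable (X : Type u) [Fintype X]

/-- The C*-seminorms on the free *-algebra on self-adjoint `x i j` in which the relations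
`x i j ^ 2 = x i j`, `∑ j, x i j = 1` and `∑ i, x i j = 1` hold. -/
def magicSeminorms : Set (CStarSeminorm (FreeStarAlgebra (X × X))) :=
  {p | (∀ i j, p (FreeStarAlgebra.X (i, j) * FreeStarAlgebra.X (i, j) -
      FreeStarAlgebra.X (i, j)) = 0) ∧
    (∀ i, p (∑ j, FreeStarAlgebra.X (i, j) - 1) = 0) ∧
    (∀ j, p (∑ i, FreeStarAlgebra.X (i, j) - 1) = 0)}

theorem CStarSeminorm.le_one_of_idem {R : Type u} [Ring R] [StarRing R] [Algebra ℂ R]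
    (p : CStarSeminorm R) (x : R) (hx : star x = x) (h : p (x * x - x) = 0) : p x ≤ 1 := by
  have h1 : p (x * x) ≤ p (x * x - x) + p x := by
    simpa using map_add_le_add p.toSeminorm (x * x - x) x
  have h2 := p.map_star_mul_self x
  rw [hx] at h2
  nlinarith [apply_nonneg p.toSeminorm x]

theorem magicSeminorms_bddAbove (x : FreeStarAlgebra (X × X)) :
    BddAbove {r : ℝ | ∃ p ∈ magicSeminorms X, r = p x} := by
  suffices h : ∃ C, ∀ p ∈ magicSeminorms X, p x ≤ C by
    obtain ⟨C, hC⟩ := h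
    exact ⟨C, by rintro r ⟨p, hp, rfl⟩; exact hC p hp⟩
  induction x using FreeStarAlgebra.induction with
  | h₀ c =>
    refine ⟨‖c‖, fun p _ => ?_⟩
    rw [Algebra.algebraMap_eq_smul_one, map_smul_eq_mul]
    exact mul_le_of_le_one_right (norm_nonneg c) (p.le_one_of_idem 1 (star_one _) (by simp))
  | h₁ s =>
    exact ⟨1, fun p hp => p.le_one_of_idem _ (FreeStarAlgebra.star_X s) (hp.1 s.1 s.2)⟩
  | h₂ x y hx hy =>
    obtain ⟨C, hC⟩ := hx
    obtain ⟨D, hD⟩ := hy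
    exact ⟨C * D, fun p hp => (p.map_mul_le x y).trans (mul_le_mul (hC p hp) (hD p hp)
      (apply_nonneg p.toSeminorm y) ((apply_nonneg p.toSeminorm x).trans (hC p hp)))⟩
  | h₃ x y hx hy =>
    obtain ⟨C, hC⟩ := hx
    obtain ⟨D, hD⟩ := hy
    exact ⟨C + D, fun p hp => (map_add_le_add p.toSeminorm x y).trans
      (add_le_add (hC p hp) (hD p hp))⟩

/-- The universal C*-algebra with generators `a i j` (`i, j ∈ X`) and relations
`a i j ^ 2 = a i j = star (a i j)`, `∑ j, a i j = 1`, `∑ i, a i j = 1`: the completion of the free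
*-algebra with respect to the largest C*-seminorm in which these relations hold. -/
abbrev QPerm : Type u :=
  (CStarSeminorm.sup (magicSeminorms X) (magicSeminorms_bddAbove X)).Completion

variable {X}

/-- The generators of `QPerm X`. -/
def QPerm.a (i j : X) : QPerm X :=
  (CStarSeminorm.sup (magicSeminorms X) (magicSeminorms_bddAbove X)).of (FreeStarAlgebra.X (i, j))

end QuantumPermutation

end

/-!
The algebra `QPerm X` represents magic unitaries: by construction, the matrices of projections with
all row and column sums `1` in a C*-algebra `D` are the *-homomorphisms `QPerm X → D`
(`QPerm.lift`, `QPerm.hom_ext`). Comultiplication, counit and antipode are the *-homomorphisms into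
`QPerm X ⊗ₘ QPerm X`, `ℂ` and the opposite algebra that belong to the matrix product of two copies
of the fundamental magic unitary, the unit matrix and the transposed matrix. The comultiplication
descends to an algebraic one on the *-subalgebra `QPerm.core X` generated by the entries because
an algebraic tensor product embeds into the minimal one (`MinTensor.of_injective`); this rests on
the existence of enough states, hence of enough Hilbert space representations
(`CStarAlgebra.exists_representation`). The antipode identities hold by orthogonality of projections
that sum to `1`, and the antipode is an involution as it is the transposition.

For the universal property, let `m` be the matrix of coefficients of an action of a compact quantum
group on the functions on `X`. Its entries are projections and its rows are partitions of unity,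
since the action is a *-homomorphism; the point is that the columns sum to `1` as well, for then
`m` is a magic unitary and defines the unique morphism. Let `s j` be the column sums and `v` the
antipode of `m`, so that `v` is inverse to `m`. Orthogonality of the rows reads `m* m = diag s`,
whence `m j i = s i * v i j` and every `s i` is invertible. Choose `k` with `‖s k‖` maximal, and a
vector state `ω` with `ω (s k) = ‖s k‖`. As the comultiplication is contractive and maps `s j` to
`∑ i, s i ⊗ m i j`, every vector state `ρ` satisfies `∑ i, ω (s i) ρ (m i j) ≤ ‖s k‖`. Here all
`ω (s i)` are positive, and at vectors in the range of `m k j` the `k`-th term exhausts the bound;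
so `m i j * m k j = 0` for `i ≠ k` (`mul_eq_zero_of_norm_colSum_le`). It follows that
`s j * m k j = m k j`, so `v j k = m k j`, and the antipode maps `s k` to `∑ j, m k j = 1`. The
antipode is inverted by `x ↦ star (antipode (star x))`, therefore `s k = 1`. By maximality all `s j`
are at most `1`, while they add up to the number of points of `X`, so all of them are `1`
(`CompactQuantumGroup.IsRowMagic.isMagic`). No invariance under a Haar state is needed.

The characters of `QPerm X` are the magic unitaries over `ℂ`, that is, the permutation matrices.
-/

noncomputable section

/-! ### States and Hilbert space representations -/

section States

open scoped ComplexOrder CStarAlgebra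

variable {A : Type u} [CStarAlgebra A]

theorem CStarAlgebra.norm_two_mul_sub_one_le [PartialOrder A] [StarOrderedRing A] {x : A}
    (hx : 0 ≤ x) (hx1 : ‖x‖ ≤ 1) : ‖2 * x - 1‖ ≤ 1 := by
  have hx1' : x ≤ 1 := (CStarAlgebra.norm_le_one_iff_of_nonneg x hx).1 hx1
  have hs : IsSelfAdjoint (2 * x - 1) :=
    by
    rw [two_mul]
    exact ((IsSelfAdjoint.of_nonneg hx).add (IsSelfAdjoint.of_nonneg hx)).sub (.one A)
  have h1 : x ^ 2 ≤ x := by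
    simpa using CStarAlgebra.pow_antitone hx hx1' (show 1 ≤ 2 by norm_num)
  have h2 : star (2 * x - 1) * (2 * x - 1) ≤ 1 := by
    rw [hs.star_eq, ← sub_nonneg]
    have h3 : (1 : A) - (2 * x - 1) * (2 * x - 1) = (4 : ℕ) • (x - x ^ 2) := by
      noncomm_ring
    rw [h3]
    exact nsmul_nonneg (sub_nonneg.2 h1) 4
  have h4 := (CStarAlgebra.norm_le_one_iff_of_nonneg _ (star_mul_self_nonneg (2 * x - 1))).2 h2
  rw [CStarRing.norm_star_mul_self] at h4
  nlinarith [norm_nonneg (2 * x - 1)]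

/-- A functional of norm at most one with `g 1 = 1` is positive. The trick for reality is the
growth of `‖x + i t‖` in the real parameter `t`. -/
theorem CStarAlgebra.nonneg_of_norm_le_one [PartialOrder A] [StarOrderedRing A]
    (g : A →L[ℂ] ℂ) (hg : ‖g‖ ≤ 1) (h1 : g 1 = 1) {x : A} (hx : 0 ≤ x) : 0 ≤ g x := by
  have hle : ∀ y, ‖g y‖ ≤ ‖y‖ := fun y => by simpa using g.le_of_opNorm_le hg y
  have h11 : ‖(1 : A)‖ ≤ 1 := by
    rcases subsingleton_or_nontrivial A with h | h
    · simp [Subsingleton.elim (1 : A) 0]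
    · simp
  have him : (g x).im = 0 := by
    have key : ∀ t : ℝ, ((g x).im + t) ^ 2 ≤ ‖x‖ ^ 2 + t ^ 2 := fun t => by
      have e1 : g (x + (t * Complex.I) • 1) = g x + t * Complex.I := by
        rw [map_add, map_smul, h1]; simp
      have e2 : ‖x + (t * Complex.I) • (1 : A)‖ ^ 2 ≤ ‖x‖ ^ 2 + t ^ 2 := by
        rw [sq, ← CStarRing.norm_star_mul_self]
        have : star (x + (t * Complex.I) • (1 : A)) * (x + (t * Complex.I) • 1) =
            x * x + ((t ^ 2 : ℝ) : ℂ) • (1 : A) := by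
          rw [star_add, (IsSelfAdjoint.of_nonneg hx).star_eq, star_smul, star_one]
          simp only [add_mul, mul_add, smul_mul_assoc, mul_smul_comm, one_mul, mul_one, smul_add,
            smul_smul]
          have h5 : star ((t : ℂ) * Complex.I) = -(t * Complex.I) := by simp
          have h6 : ((t : ℂ) * Complex.I) * -(t * Complex.I) = ((t ^ 2 : ℝ) : ℂ) := by
            push_cast; linear_combination (-(t : ℂ) ^ 2) * Complex.I_sq
          rw [h5, h6, neg_smul]
          abel
        rw [this]
        refine (norm_add_le _ _).trans (add_le_add ?_ ?_)
        · rw [sq]; exact norm_mul_le _ _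
        · rw [norm_smul, Complex.norm_real, Real.norm_of_nonneg (sq_nonneg t)]
          exact mul_le_of_le_one_right (sq_nonneg t) h11
      have e3 := hle (x + (t * Complex.I) • 1)
      rw [e1] at e3
      have e4 : |(g x + t * Complex.I).im| ≤ ‖g x + t * Complex.I‖ := Complex.abs_im_le_norm _
      have e5 : (g x + t * Complex.I).im = (g x).im + t := by simp
      rw [e5] at e4
      calc ((g x).im + t) ^ 2 = |(g x).im + t| ^ 2 := (sq_abs _).symm
        _ ≤ ‖x + (t * Complex.I) • (1 : A)‖ ^ 2 :=
          pow_le_pow_left₀ (abs_nonneg _) (e4.trans e3) 2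
        _ ≤ _ := e2
    by_contra h
    have := key ((‖x‖ ^ 2 + 1) / (2 * (g x).im))
    have e : 2 * (g x).im * ((‖x‖ ^ 2 + 1) / (2 * (g x).im)) = ‖x‖ ^ 2 + 1 := by field_simp
    nlinarith [sq_nonneg (g x).im]
  have hre : 0 ≤ (g x).re := by
    by_cases h0 : x = 0
    · simp [h0]
    have hp : 0 < ‖x‖ := norm_pos_iff.2 h0
    have e1 : ‖(2 : A) * ((‖x‖⁻¹ : ℝ) • x) - 1‖ ≤ 1 :=
      CStarAlgebra.norm_two_mul_sub_one_le (smul_nonneg (inv_nonneg.2 hp.le) hx)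
        (by rw [norm_smul, norm_inv, norm_norm, inv_mul_cancel₀ hp.ne'])
    have e2 : g ((2 : A) * ((‖x‖⁻¹ : ℝ) • x) - 1) = 2 * ((‖x‖⁻¹ : ℝ) * g x) - 1 := by
      rw [map_sub, h1, ← Complex.coe_smul, two_mul, map_add, map_smul, smul_eq_mul]; ring
    have e3 := (hle _).trans e1
    rw [e2] at e3
    have e4 := (Complex.abs_re_le_norm _).trans e3
    have e5 : (2 * ((‖x‖⁻¹ : ℝ) * g x) - 1 : ℂ).re = 2 * (‖x‖⁻¹ * (g x).re) - 1 := by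
      simp [-Complex.ofReal_inv]
    rw [e5] at e4
    have e6 : 0 ≤ ‖x‖⁻¹ * (g x).re := by linarith [(abs_le.1 e4).1]
    exact nonneg_of_mul_nonneg_right e6 (inv_pos.2 hp)
  exact Complex.nonneg_iff.2 ⟨hre, him.symm⟩

/-- The norm of a nonzero positive element is attained at a state. A norming functional
of the normalised element `x` is a state because both `1` and `2 * x - 1` have norm at most one. -/
theorem CStarAlgebra.exists_state [PartialOrder A] [StarOrderedRing A] {x : A} (hx : 0 ≤ x)
    (h0 : x ≠ 0) : ∃ f : A →ₚ[ℂ] ℂ, f 1 = 1 ∧ f x = ‖x‖ := by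
  have hp : 0 < ‖x‖ := norm_pos_iff.2 h0
  have : Nontrivial A := ⟨⟨x, 0, h0⟩⟩
  obtain ⟨g, hg, hgx⟩ := exists_dual_vector ℂ x hp.ne'
  have hle : ∀ y, ‖g y‖ ≤ ‖y‖ := fun y => by simpa using g.le_of_opNorm_le hg.le y
  have h1 : g 1 = 1 := by
    have e1 : ‖(2 : A) * ((‖x‖⁻¹ : ℝ) • x) - 1‖ ≤ 1 :=
      CStarAlgebra.norm_two_mul_sub_one_le (smul_nonneg (inv_nonneg.2 hp.le) hx)
        (by rw [norm_smul, norm_inv, norm_norm, inv_mul_cancel₀ hp.ne'])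
    have e2 : g ((2 : A) * ((‖x‖⁻¹ : ℝ) • x) - 1) = 2 - g 1 := by
      rw [map_sub, ← Complex.coe_smul, two_mul, map_add, map_smul, hgx, smul_eq_mul]
      have : ((‖x‖⁻¹ : ℝ) : ℂ) * ((‖x‖ : ℝ) : ℂ) = 1 := by
        rw [← Complex.ofReal_mul, inv_mul_cancel₀ hp.ne', Complex.ofReal_one]
      erw [this]; norm_num
    have e3 := (hle _).trans e1
    rw [e2] at e3
    have e4 : ‖g 1‖ ≤ 1 := by simpa using hle 1
    have e5 := (abs_le.1 ((Complex.abs_re_le_norm _).trans e3)).2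
    rw [Complex.sub_re] at e5
    have e6 : (1 : ℝ) ≤ (g 1).re := by
      have : (2 : ℂ).re = 2 := rfl
      linarith
    have e7 : ‖g 1‖ ^ 2 = (g 1).re ^ 2 + (g 1).im ^ 2 := by
      rw [Complex.sq_norm, Complex.normSq_apply]; ring
    have e8 : ‖g 1‖ ^ 2 ≤ 1 := pow_le_one₀ (norm_nonneg _) e4
    have e9 : (g 1).im = 0 := by nlinarith [sq_nonneg (g 1).im]
    refine Complex.ext ?_ e9
    have e10 : (g 1).re ≤ 1 := (Complex.re_le_norm _).trans e4
    exact le_antisymm e10 e6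
  exact ⟨PositiveLinearMap.mk₀ g.toLinearMap fun y hy =>
    CStarAlgebra.nonneg_of_norm_le_one g hg.le h1 hy, h1, hgx⟩

/-- The norm of a nonzero positive element is attained at a vector state: this is the cyclic vector
of the GNS representation of a norming state. -/
theorem CStarAlgebra.exists_representation [PartialOrder A] [StarOrderedRing A] {x : A}
    (hx : 0 ≤ x) (h0 : x ≠ 0) :
    ∃ (H : Type u) (_ : NormedAddCommGroup H) (_ : InnerProductSpace ℂ H) (_ : CompleteSpace H)
      (π : A →⋆ₐ[ℂ] (H →L[ℂ] H)) (ξ : H), ‖ξ‖ = 1 ∧ ⟪ξ, π x ξ⟫_ℂ = ‖x‖ := by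
  obtain ⟨f, h1, hfx⟩ := CStarAlgebra.exists_state hx h0
  refine ⟨f.GNS, inferInstance, inferInstance, inferInstance, f.gnsStarAlgHom,
    (f.toPreGNS 1 : f.PreGNS), ?_, ?_⟩
  · rw [UniformSpace.Completion.norm_coe, f.preGNS_norm_def]
    simp [h1]
  · erw [PositiveLinearMap.gnsStarAlgHom_apply, PositiveLinearMap.gnsNonUnitalStarAlgHom_apply_coe]
    rw [UniformSpace.Completion.inner_coe, f.preGNS_inner_def, ← hfx]
    simp

/-- The Hilbert space representations of a C*-algebra separate its elements. -/
theorem CStarAlgebra.exists_representation_ne_zero {a : A} (ha : a ≠ 0) :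
    ∃ (H : Type u) (_ : NormedAddCommGroup H) (_ : InnerProductSpace ℂ H) (_ : CompleteSpace H)
      (π : A →⋆ₐ[ℂ] (H →L[ℂ] H)), π a ≠ 0 := by
  let _ := CStarAlgebra.spectralOrder A
  have := CStarAlgebra.spectralOrderedRing A
  have h0 : star a * a ≠ 0 := fun h => ha (CStarRing.star_mul_self_eq_zero_iff a |>.1 h)
  obtain ⟨H, i1, i2, i3, π, ξ, -, h⟩ :=
    CStarAlgebra.exists_representation (star_mul_self_nonneg a) h0
  refine ⟨H, i1, i2, i3, π, fun h' => h0 ?_⟩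
  rw [map_mul, h', mul_zero] at h
  simpa using h.symm

end States

/-! ### Injectivity of the algebraic into the minimal tensor product -/

section Injectivity

variable {A B : Type u} [CStarAlgebra A] [CStarAlgebra B]

theorem norm_repTensor_le {H K : Type u} [NormedAddCommGroup H] [InnerProductSpace ℂ H]
    [CompleteSpace H] [NormedAddCommGroup K] [InnerProductSpace ℂ K] [CompleteSpace K]
    (π : A →⋆ₐ[ℂ] (H →L[ℂ] H)) (ρ : B →⋆ₐ[ℂ] (K →L[ℂ] K)) (z : A ⊗[ℂ] B) :
    ‖repTensor π ρ z‖ ≤ ‖(MinTensor.of z : A ⊗ₘ B)‖ :=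
  (le_csSup (spatialSeminorms_bddAbove A B z)
    ⟨CStarSeminorm.ofHom (repTensor π ρ), ⟨H, K, _, _, _, _, _, _, _, _, rfl⟩, rfl⟩).trans_eq
    ((minSeminorm A B).norm_incl z).symm

/-- The matrix coefficient `a ↦ ⟪ξ, π a ξ'⟫` of a representation. -/
def matrixCoeff {H : Type u} [NormedAddCommGroup H] [InnerProductSpace ℂ H] [CompleteSpace H]
    (π : A →⋆ₐ[ℂ] (H →L[ℂ] H)) (ξ ξ' : H) : A →ₗ[ℂ] ℂ :=
  ((innerSL ℂ ξ).comp (ContinuousLinearMap.apply ℂ H ξ')).toLinearMap ∘ₗ π.toAlgHom.toLinearMap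

theorem matrixCoeff_apply {H : Type u} [NormedAddCommGroup H] [InnerProductSpace ℂ H]
    [CompleteSpace H] (π : A →⋆ₐ[ℂ] (H →L[ℂ] H)) (ξ ξ' : H) (a : A) :
    matrixCoeff π ξ ξ' a = ⟪ξ, π a ξ'⟫_ℂ := rfl

theorem inner_repTensor {H K : Type u} [NormedAddCommGroup H] [InnerProductSpace ℂ H]
    [CompleteSpace H] [NormedAddCommGroup K] [InnerProductSpace ℂ K] [CompleteSpace K]
    (π : A →⋆ₐ[ℂ] (H →L[ℂ] H)) (ρ : B →⋆ₐ[ℂ] (K →L[ℂ] K)) (ξ ξ' : H) (η η' : K) (z : A ⊗[ℂ] B) :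
    ⟪HilbertTensor.of (ξ ⊗ₜ[ℂ] η), repTensor π ρ z (HilbertTensor.of (ξ' ⊗ₜ[ℂ] η'))⟫_ℂ =
      LinearMap.mul' ℂ ℂ (TensorProduct.map (matrixCoeff π ξ ξ') (matrixCoeff ρ η η') z) := by
  induction z with
  | zero => simp
  | add x y hx hy => simp only [map_add, add_apply, inner_add_right, hx, hy]
  | tmul a b =>
    rw [repTensor_tmul, opTensor_of, LinearIsometry.inner_map_map]
    simp [matrixCoeff_apply]

theorem eq_zero_of_matrixCoeff {a : A} (h : ∀ (H : Type u) (_ : NormedAddCommGroup H)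
    (_ : InnerProductSpace ℂ H) (_ : CompleteSpace H) (π : A →⋆ₐ[ℂ] (H →L[ℂ] H)) (ξ ξ' : H),
    matrixCoeff π ξ ξ' a = 0) : a = 0 := by
  by_contra ha
  obtain ⟨H, i1, i2, i3, π, hπ⟩ := CStarAlgebra.exists_representation_ne_zero ha
  refine hπ (ContinuousLinearMap.ext fun ξ => ?_)
  exact inner_self_eq_zero.1 (h H i1 i2 i3 π (π a ξ) ξ)

/-- The minimal C*-seminorm is a norm: slicing by matrix coefficients of representations of `B` and
of `A` separates the elements of the algebraic tensor product. -/
theorem MinTensor.of_injective : Function.Injective (MinTensor.of : A ⊗[ℂ] B →⋆ₐ[ℂ] A ⊗ₘ B) := by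
  rw [injective_iff_map_eq_zero]
  intro z hz
  have key : ∀ (H : Type u) (_ : NormedAddCommGroup H) (_ : InnerProductSpace ℂ H)
      (_ : CompleteSpace H) (π : A →⋆ₐ[ℂ] (H →L[ℂ] H)) (ξ ξ' : H) (K : Type u)
      (_ : NormedAddCommGroup K) (_ : InnerProductSpace ℂ K) (_ : CompleteSpace K)
      (ρ : B →⋆ₐ[ℂ] (K →L[ℂ] K)) (η η' : K),
      LinearMap.mul' ℂ ℂ (TensorProduct.map (matrixCoeff π ξ ξ') (matrixCoeff ρ η η') z) = 0 := by
    intro H _ _ _ π ξ ξ' K _ _ _ ρ η η'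
    have h := norm_repTensor_le π ρ z
    rw [hz, norm_zero, norm_le_zero_iff] at h
    rw [← inner_repTensor, h, zero_apply, inner_zero_right]
  -- the coefficients of `z` with respect to a basis of `B` have vanishing slices
  let b := Module.Basis.ofVectorSpace ℂ B
  obtain ⟨c, rfl⟩ := TensorProduct.eq_repr_basis_right b z
  suffices h : c = 0 by rw [h, Finsupp.sum_zero_index]
  ext i
  refine eq_zero_of_matrixCoeff fun H _ _ _ π ξ ξ' => ?_
  have h1 : ∑ j ∈ c.support, matrixCoeff π ξ ξ' (c j) • b j = 0 := by
    refine eq_zero_of_matrixCoeff fun K _ _ _ ρ η η' => ?_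
    have := key H _ _ _ π ξ ξ' K _ _ _ ρ η η'
    rw [Finsupp.sum, map_sum, map_sum] at this
    rw [map_sum, ← this]
    exact Finset.sum_congr rfl fun j _ => by simp
  by_cases hi : i ∈ c.support
  · exact linearIndependent_iff'.1 b.linearIndependent _ _ h1 i hi
  · rw [Finsupp.notMem_support_iff.1 hi, map_zero]

theorem MinTensor.ofSub_injective (𝒜 : StarSubalgebra ℂ A) (ℬ : StarSubalgebra ℂ B) :
    Function.Injective (MinTensor.ofSub 𝒜 ℬ) :=
  MinTensor.of_injective.comp
    (TensorProduct.map_injective_of_flat_flat _ _ Subtype.val_injective Subtype.val_injective)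

end Injectivity

/-! ### Magic unitaries and the universal property -/

/-- A magic unitary: a square matrix of projections whose rows and columns sum to `1`. -/
structure IsMagic {X : Type*} [Fintype X] {R : Type*} [Ring R] [StarRing R] (m : X → X → R) :
    Prop where
  idem : ∀ i j, m i j * m i j = m i j
  star_eq : ∀ i j, star (m i j) = m i j
  row : ∀ i, ∑ j, m i j = 1
  col : ∀ j, ∑ i, m i j = 1

/-- Projections in a C*-algebra that sum to `1` are mutually orthogonal. -/
theorem mul_eq_zero_of_sum_eq_one {ι D : Type*} [Fintype ι] [CStarAlgebra D]
    {p : ι → D} (hp : ∀ i, p i * p i = p i) (hs : ∀ i, star (p i) = p i) (h1 : ∑ i, p i = 1)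
    {i j : ι} (hij : i ≠ j) : p i * p j = 0 := by
  classical
  let _ := CStarAlgebra.spectralOrder D
  have := CStarAlgebra.spectralOrderedRing D
  have e : ∀ k, p j * p k * p j = star (p k * p j) * (p k * p j) := fun k => by
    rw [star_mul, hs, hs, ← mul_assoc, mul_assoc (p j) (p k) (p k), hp]
  have h2 : ∑ k, p j * p k * p j = p j := by
    rw [← Finset.sum_mul, ← Finset.mul_sum, h1, mul_one, hp]
  rw [← Finset.add_sum_erase _ _ (Finset.mem_univ j), hp, hp, add_eq_left] at h2
  rw [Finset.sum_eq_zero_iff_of_nonneg (fun k _ => by rw [e]; exact star_mul_self_nonneg _)] at h2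
  have h3 := h2 i (Finset.mem_erase.2 ⟨hij, Finset.mem_univ i⟩)
  rw [e] at h3
  exact (CStarRing.star_mul_self_eq_zero_iff _).1 h3

namespace IsMagic

variable {X : Type*} [Fintype X] {D : Type*} [CStarAlgebra D] {m : X → X → D}

theorem row_mul [DecidableEq X] (h : IsMagic m) (i j k : X) :
    m i j * m i k = if j = k then m i j else 0 := by
  split_ifs with hjk
  · rw [hjk, h.idem]
  · exact mul_eq_zero_of_sum_eq_one (h.idem i) (h.star_eq i) (h.row i) hjk

theorem col_mul [DecidableEq X] (h : IsMagic m) (i j k : X) :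
    m i k * m j k = if i = j then m i k else 0 := by
  split_ifs with hij
  · rw [hij, h.idem]
  · exact mul_eq_zero_of_sum_eq_one (p := fun i => m i k) (fun i => h.idem i k)
      (fun i => h.star_eq i k) (h.col k) hij

end IsMagic

namespace FreeStarAlgebra

variable {S : Type u} {D : Type*} [Ring D] [StarRing D] [Algebra ℂ D] [StarModule ℂ D]

/-- The *-homomorphism on the free *-algebra defined by a family of self-adjoint elements. -/
def lift (f : S → D) (hf : ∀ s, star (f s) = f s) : FreeStarAlgebra S →⋆ₐ[ℂ] D :=
  let φ : FreeStarAlgebra S →ₐ[ℂ] D := FreeAlgebra.lift ℂ f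
  have hφ : ∀ s, φ (X s) = f s := fun s => FreeAlgebra.lift_ι_apply f s
  { φ with
    map_star' := fun x => by
      change φ (star x) = star (φ x)
      induction x using induction with
      | h₀ c => rw [star_algebraMap, AlgHom.commutes, AlgHom.commutes, algebraMap_star_comm]
      | h₁ s => rw [star_X, hφ, hf]
      | h₂ x y hx hy => rw [star_mul, map_mul, map_mul, star_mul, hx, hy]
      | h₃ x y hx hy => rw [star_add, map_add, map_add, star_add, hx, hy] }

theorem lift_X (f : S → D) (hf : ∀ s, star (f s) = f s) (s : S) : lift f hf (X s) = f s :=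
  FreeAlgebra.lift_ι_apply f s

end FreeStarAlgebra

namespace QPerm

variable {X : Type u} [Fintype X]

/-- The canonical map from the free *-algebra to `QPerm X`. -/
def ofFree : FreeStarAlgebra (X × X) →⋆ₐ[ℂ] QPerm X :=
  (CStarSeminorm.sup (magicSeminorms X) (magicSeminorms_bddAbove X)).of

theorem ofFree_X (ij : X × X) : ofFree (FreeStarAlgebra.X ij) = a ij.1 ij.2 := rfl

theorem norm_ofFree (x : FreeStarAlgebra (X × X)) : ‖ofFree x‖ =
    CStarSeminorm.sup (magicSeminorms X) (magicSeminorms_bddAbove X) x :=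
  CStarSeminorm.norm_incl _ x

theorem le_norm_ofFree {p : CStarSeminorm (FreeStarAlgebra (X × X))} (hp : p ∈ magicSeminorms X)
    (x : FreeStarAlgebra (X × X)) : p x ≤ ‖ofFree x‖ :=
  (le_csSup (magicSeminorms_bddAbove X x) ⟨p, hp, rfl⟩).trans_eq (norm_ofFree x).symm

theorem ofFree_eq_zero {x : FreeStarAlgebra (X × X)} (h : ∀ p ∈ magicSeminorms X, p x = 0) :
    ofFree x = 0 := by
  rw [← norm_le_zero_iff, norm_ofFree]
  refine Real.sSup_le ?_ le_rfl
  rintro r ⟨p, hp, rfl⟩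
  exact (h p hp).le

theorem isMagic_a : IsMagic (a : X → X → QPerm X) where
  idem i j := by
    rw [← sub_eq_zero, ← ofFree_X (i, j), ← map_mul, ← map_sub]
    exact ofFree_eq_zero fun p hp => hp.1 i j
  star_eq i j := by
    rw [← ofFree_X (i, j), ← StarHomClass.map_star, FreeStarAlgebra.star_X]
  row i := by
    rw [← sub_eq_zero, ← map_one ofFree, Finset.sum_congr rfl fun j _ => (ofFree_X (i, j)).symm,
      ← map_sum, ← map_sub]
    exact ofFree_eq_zero fun p hp => hp.2.1 i
  col j := by
    rw [← sub_eq_zero, ← map_one ofFree, Finset.sum_congr rfl fun i _ => (ofFree_X (i, j)).symm,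
      ← map_sum, ← map_sub]
    exact ofFree_eq_zero fun p hp => hp.2.2 j

section Lift

variable {D : Type*} [CStarAlgebra D]

theorem norm_lift_le {m : X → X → D} (hm : IsMagic m) (x : FreeStarAlgebra (X × X)) :
    ‖FreeStarAlgebra.lift (fun ij : X × X => m ij.1 ij.2) (fun ij => hm.star_eq ij.1 ij.2) x‖ ≤
      ‖ofFree x‖ := by
  refine le_norm_ofFree
    (p := CStarSeminorm.ofHom (FreeStarAlgebra.lift _ fun ij => hm.star_eq ij.1 ij.2)) ?_ x
  refine ⟨fun i j => ?_, fun i => ?_, fun j => ?_⟩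
  · change ‖FreeStarAlgebra.lift _ _ _‖ = 0
    rw [map_sub, map_mul, FreeStarAlgebra.lift_X, hm.idem, sub_self, norm_zero]
  · change ‖FreeStarAlgebra.lift _ _ _‖ = 0
    simp only [map_sub, map_sum, map_one, FreeStarAlgebra.lift_X, hm.row, sub_self, norm_zero]
  · change ‖FreeStarAlgebra.lift _ _ _‖ = 0
    simp only [map_sub, map_sum, map_one, FreeStarAlgebra.lift_X, hm.col, sub_self, norm_zero]

/-- The *-homomorphism on `QPerm X` defined by a magic unitary in a C*-algebra. -/
def lift (m : X → X → D) (hm : IsMagic m) : QPerm X →⋆ₐ[ℂ] D :=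
  (CStarSeminorm.sup (magicSeminorms X) (magicSeminorms_bddAbove X)).lift
    (FreeStarAlgebra.lift (fun ij : X × X => m ij.1 ij.2) fun ij => hm.star_eq ij.1 ij.2)
    fun x => (norm_lift_le hm x).trans_eq (norm_ofFree x)

theorem lift_a (m : X → X → D) (hm : IsMagic m) (i j : X) : lift m hm (a i j) = m i j :=
  (CStarSeminorm.lift_of _ _ _ _).trans (FreeStarAlgebra.lift_X _ _ (i, j))

end Lift

/-! ### The dense *-subalgebra generated by the entries -/

variable (X) in
/-- The *-subalgebra generated by the entries of the fundamental magic unitary. -/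
def core : StarSubalgebra ℂ (QPerm X) :=
  StarAlgebra.adjoin ℂ (Set.range fun ij : X × X => a ij.1 ij.2)

/-- The entries of the fundamental magic unitary, as elements of `core X`. -/
def gen (i j : X) : core X :=
  ⟨a i j, StarAlgebra.subset_adjoin ℂ _ ⟨(i, j), rfl⟩⟩

theorem coe_gen (i j : X) : (gen i j : QPerm X) = a i j := rfl

theorem star_gen (i j : X) : star (gen i j) = gen i j := Subtype.ext (isMagic_a.star_eq i j)

theorem sum_gen_row (i : X) : ∑ j, gen i j = 1 :=
  Subtype.ext (by rw [AddSubmonoidClass.coe_finsetSum]; exact isMagic_a.row i)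

theorem sum_gen_col (j : X) : ∑ i, gen i j = 1 :=
  Subtype.ext (by rw [AddSubmonoidClass.coe_finsetSum]; exact isMagic_a.col j)

theorem gen_row_mul [DecidableEq X] (i j k : X) :
    gen i j * gen i k = if j = k then gen i j else 0 :=
  Subtype.ext <| (isMagic_a.row_mul i j k).trans <| by split_ifs <;> rfl

theorem gen_col_mul [DecidableEq X] (i j k : X) :
    gen i k * gen j k = if i = j then gen i k else 0 :=
  Subtype.ext <| (isMagic_a.col_mul i j k).trans <| by split_ifs <;> rfl

/-- The canonical map from the free *-algebra onto `core X`. -/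
def coreOfFree : FreeStarAlgebra (X × X) →⋆ₐ[ℂ] core X :=
  FreeStarAlgebra.lift (fun ij : X × X => gen ij.1 ij.2) fun ij => star_gen ij.1 ij.2

theorem coreOfFree_X (ij : X × X) : coreOfFree (FreeStarAlgebra.X ij) = gen ij.1 ij.2 :=
  FreeStarAlgebra.lift_X _ _ ij

theorem coe_coreOfFree (x : FreeStarAlgebra (X × X)) :
    (coreOfFree x : QPerm X) = ofFree x := by
  induction x using FreeStarAlgebra.induction with
  | h₀ c => rw [AlgHomClass.commutes, AlgHomClass.commutes]; rfl
  | h₁ s => rw [coreOfFree_X, ofFree_X, coe_gen]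
  | h₂ x y hx hy => rw [map_mul, map_mul, ← hx, ← hy]; rfl
  | h₃ x y hx hy => rw [map_add, map_add, ← hx, ← hy]; rfl

theorem ofFree_mem_core (x : FreeStarAlgebra (X × X)) : ofFree x ∈ core X :=
  coe_coreOfFree x ▸ (coreOfFree x).2

theorem coreOfFree_surjective : Function.Surjective (coreOfFree : _ →⋆ₐ[ℂ] core X) := by
  have h : core X ≤ (ofFree : _ →⋆ₐ[ℂ] QPerm X).range := by
    refine StarAlgebra.adjoin_le ?_
    rintro _ ⟨ij, rfl⟩
    exact ⟨FreeStarAlgebra.X ij, rfl⟩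
  rintro ⟨x, hx⟩
  obtain ⟨y, rfl⟩ := h hx
  exact ⟨y, Subtype.ext (coe_coreOfFree y)⟩

/-- As the generators are self-adjoint, `core X` is generated by them as an algebra. -/
theorem core_induction {P : core X → Prop} (h₀ : ∀ c, P (algebraMap ℂ _ c))
    (h₁ : ∀ i j, P (gen i j)) (h₂ : ∀ x y, P x → P y → P (x * y))
    (h₃ : ∀ x y, P x → P y → P (x + y)) (x : core X) : P x := by
  obtain ⟨x, rfl⟩ := coreOfFree_surjective x
  induction x using FreeStarAlgebra.induction with
  | h₀ c => rw [AlgHomClass.commutes]; exact h₀ c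
  | h₁ s => rw [coreOfFree_X]; exact h₁ _ _
  | h₂ x y hx hy => rw [map_mul]; exact h₂ _ _ hx hy
  | h₃ x y hx hy => rw [map_add]; exact h₃ _ _ hx hy

theorem core_hom_ext {D : Type*} [Semiring D] [Algebra ℂ D] {f g : core X →ₐ[ℂ] D}
    (h : ∀ i j, f (gen i j) = g (gen i j)) : f = g := by
  ext x
  induction x using core_induction with
  | h₀ c => rw [AlgHom.commutes, AlgHom.commutes]
  | h₁ i j => exact h i j
  | h₂ x y hx hy => rw [map_mul, map_mul, hx, hy]
  | h₃ x y hx hy => rw [map_add, map_add, hx, hy]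

theorem dense_core : Dense (core X : Set (QPerm X)) :=
  (CStarSeminorm.denseRange_incl _).mono (by rintro _ ⟨x, rfl⟩; exact ofFree_mem_core x)

theorem hom_ext {D : Type*} [CStarAlgebra D] {f g : QPerm X →⋆ₐ[ℂ] D}
    (h : ∀ i j, f (a i j) = g (a i j)) : f = g := by
  have hc : (f.comp (core X).subtype).toAlgHom = (g.comp (core X).subtype).toAlgHom :=
    core_hom_ext h
  refine DFunLike.coe_injective (Continuous.ext_on dense_core ?_ ?_ ?_)
  · exact AddMonoidHomClass.continuous_of_bound f 1 fun x => by
      rw [one_mul]; exact NonUnitalStarAlgHom.norm_apply_le f x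
  · exact AddMonoidHomClass.continuous_of_bound g 1 fun x => by
      rw [one_mul]; exact NonUnitalStarAlgHom.norm_apply_le g x
  · intro x hx
    exact DFunLike.congr_fun hc ⟨x, hx⟩

/-- Every C*-seminorm on `core X` is dominated by the norm of `QPerm X`: its pull-back to the free
*-algebra satisfies the magic relations. -/
theorem core_full (p : CStarSeminorm (core X)) (x : core X) : p x ≤ ‖(x : QPerm X)‖ := by
  obtain ⟨x, rfl⟩ := coreOfFree_surjective x
  let q : CStarSeminorm (FreeStarAlgebra (X × X)) :=
    { p.toSeminorm.comp coreOfFree.toAlgHom.toLinearMap with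
      map_mul_le' := fun x y => by
        change p (coreOfFree (x * y)) ≤ _
        rw [map_mul]
        exact p.map_mul_le _ _
      map_star_mul_self' := fun x => by
        change p (coreOfFree (star x * x)) = _
        rw [map_mul, StarHomClass.map_star]
        exact p.map_star_mul_self _ }
  have hq : ∀ y, coreOfFree y = 0 → q y = 0 := fun y hy => by
    change p (coreOfFree y) = 0
    rw [hy]
    exact map_zero p.toSeminorm
  rw [coe_coreOfFree]
  refine le_norm_ofFree (p := q) ⟨fun i j => hq _ ?_, fun i => hq _ ?_, fun j => hq _ ?_⟩ x
  · classical
    rw [map_sub, map_mul, coreOfFree_X, gen_row_mul, if_pos rfl, sub_self]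
  · simp only [map_sub, map_sum, map_one, coreOfFree_X, sum_gen_row, sub_self]
  · simp only [map_sub, map_sum, map_one, coreOfFree_X, sum_gen_col, sub_self]

end QPerm

/-! ### The Hopf *-algebra structure -/

theorem IsMagic.map {X : Type*} [Fintype X] {R R' : Type*} [Ring R] [StarRing R] [Algebra ℂ R]
    [Ring R'] [StarRing R'] [Algebra ℂ R'] {m : X → X → R} (h : IsMagic m) (f : R →⋆ₐ[ℂ] R') :
    IsMagic fun i j => f (m i j) where
  idem i j := by rw [← map_mul, h.idem]
  star_eq i j := by rw [← StarHomClass.map_star, h.star_eq]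
  row i := by rw [← map_sum, h.row, map_one]
  col j := by rw [← map_sum, h.col, map_one]

theorem IsMagic.op_transpose {X : Type*} [Fintype X] {R : Type*} [Ring R] [StarRing R]
    {m : X → X → R} (h : IsMagic m) : IsMagic fun i j => MulOpposite.op (m j i) where
  idem i j := by rw [← MulOpposite.op_mul, h.idem]
  star_eq i j := by rw [← MulOpposite.op_star, h.star_eq]
  row i := by
    rw [← MulOpposite.op_one, ← h.col i]
    exact (map_sum (MulOpposite.opAddEquiv (α := R)) (fun j => m j i) Finset.univ).symm
  col j := by
    rw [← MulOpposite.op_one, ← h.row j]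
    exact (map_sum (MulOpposite.opAddEquiv (α := R)) (fun i => m j i) Finset.univ).symm

/-- The matrix product of a magic unitary with itself in the tensor square. -/
theorem IsMagic.tensor {X : Type*} [Fintype X] {D : Type*} [CStarAlgebra D]
    {m : X → X → D} (h : IsMagic m) : IsMagic fun i j => ∑ k, m i k ⊗ₜ[ℂ] m k j where
  idem i j := by
    classical
    simp only [Finset.sum_mul, Finset.mul_sum, Algebra.TensorProduct.tmul_mul_tmul, h.row_mul]
    simp [TensorProduct.ite_tmul, h.idem]
  star_eq i j := by simp [h.star_eq]
  row i := by
    rw [Finset.sum_comm]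
    simp only [← TensorProduct.tmul_sum, ← TensorProduct.sum_tmul, h.row,
      Algebra.TensorProduct.one_def]
  col j := by
    rw [Finset.sum_comm]
    simp only [← TensorProduct.tmul_sum, ← TensorProduct.sum_tmul, h.col,
      Algebra.TensorProduct.one_def]

/-- The permutation matrix with the entry `1` of column `j` in row `σ j`, which is the transpose of
`Equiv.Perm.permMatrix`. -/
theorem isMagic_perm {X : Type*} [Fintype X] [DecidableEq X] (σ : Equiv.Perm X) :
    IsMagic fun i j => if σ j = i then (1 : ℂ) else 0 where
  idem i j := by simp
  star_eq i j := by split_ifs <;> simp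
  row i := by simp [← Equiv.eq_symm_apply]
  col j := by simp

namespace QPerm

variable {X : Type u} [Fintype X]

/-- The character of `QPerm X` defined by a permutation. -/
def char [DecidableEq X] (σ : Equiv.Perm X) : QPerm X →⋆ₐ[ℂ] ℂ := lift _ (isMagic_perm σ)

theorem char_a [DecidableEq X] (σ : Equiv.Perm X) (i j : X) :
    char σ (a i j) = if σ j = i then 1 else 0 := lift_a _ _ i j

variable (X) in
/-- The comultiplication `a i j ↦ ∑ k, a i k ⊗ a k j` of `QPerm X`. -/
def comul : QPerm X →⋆ₐ[ℂ] QPerm X ⊗ₘ QPerm X :=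
  lift _ (isMagic_a.tensor.map MinTensor.of)

theorem comul_a (i j : X) : comul X (a i j) = ∑ k, MinTensor.tmul (a i k) (a k j) := by
  rw [comul, lift_a, map_sum]
  rfl

/-- The algebraic comultiplication, lifted to the free *-algebra. -/
def freeComul : FreeStarAlgebra (X × X) →⋆ₐ[ℂ] core X ⊗[ℂ] core X :=
  FreeStarAlgebra.lift (fun ij : X × X => ∑ k, gen ij.1 k ⊗ₜ[ℂ] gen k ij.2) fun ij => by
    simp [star_gen]

theorem ofSub_freeComul (x : FreeStarAlgebra (X × X)) :
    MinTensor.ofSub (core X) (core X) (freeComul x) = comul X (ofFree x) := by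
  let ι : core X ⊗[ℂ] core X →ₐ[ℂ] QPerm X ⊗ₘ QPerm X :=
    MinTensor.of.toAlgHom.comp
      (Algebra.TensorProduct.map (core X).subtype.toAlgHom (core X).subtype.toAlgHom)
  change ι (freeComul x) = _
  induction x using FreeStarAlgebra.induction with
  | h₀ c => simp only [AlgHomClass.commutes]
  | h₁ s => rw [freeComul, FreeStarAlgebra.lift_X, ofFree_X, comul_a, map_sum]; rfl
  | h₂ x y hx hy => simp only [map_mul, hx, hy]
  | h₃ x y hx hy => simp only [map_add, hx, hy]

/-- A *-homomorphism on the free *-algebra that kills the relations of `core X` descends. -/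
def descend {D : Type*} [Ring D] [StarRing D] [Algebra ℂ D]
    (f : FreeStarAlgebra (X × X) →⋆ₐ[ℂ] D) (hf : ∀ x, coreOfFree x = 0 → f x = 0) :
    core X →⋆ₐ[ℂ] D :=
  let g : core X → D := fun x => f (Function.surjInv coreOfFree_surjective x)
  have hg : ∀ x, g (coreOfFree x) = f x := fun x => by
    rw [← sub_eq_zero, ← map_sub]
    refine hf _ ?_
    rw [map_sub, Function.surjInv_eq coreOfFree_surjective, sub_self]
  { toFun := g
    map_one' := by rw [← map_one coreOfFree, hg, map_one]
    map_zero' := by rw [← map_zero coreOfFree, hg, map_zero]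
    map_mul' := fun x y => by
      obtain ⟨x, rfl⟩ := coreOfFree_surjective x
      obtain ⟨y, rfl⟩ := coreOfFree_surjective y
      rw [← map_mul, hg, hg, hg, map_mul]
    map_add' := fun x y => by
      obtain ⟨x, rfl⟩ := coreOfFree_surjective x
      obtain ⟨y, rfl⟩ := coreOfFree_surjective y
      rw [← map_add, hg, hg, hg, map_add]
    commutes' := fun c => by
      rw [← AlgHomClass.commutes (coreOfFree : _ →⋆ₐ[ℂ] core X), hg, AlgHomClass.commutes]
    map_star' := fun x => by
      obtain ⟨x, rfl⟩ := coreOfFree_surjective x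
      rw [← StarHomClass.map_star, hg, hg, StarHomClass.map_star] }

theorem descend_apply {D : Type*} [Ring D] [StarRing D] [Algebra ℂ D]
    (f : FreeStarAlgebra (X × X) →⋆ₐ[ℂ] D) (hf : ∀ x, coreOfFree x = 0 → f x = 0)
    (x : FreeStarAlgebra (X × X)) : descend f hf (coreOfFree x) = f x := by
  change f _ = f x
  rw [← sub_eq_zero, ← map_sub]
  refine hf _ ?_
  rw [map_sub, Function.surjInv_eq coreOfFree_surjective, sub_self]

variable (X) in
/-- The comultiplication of the Hopf *-algebra `core X`. It is well defined as the algebraic tensor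
square of `core X` embeds into the minimal tensor square of `QPerm X`, where `comul X` is
defined. -/
def coreComul : core X →⋆ₐ[ℂ] core X ⊗[ℂ] core X :=
  descend freeComul fun x hx => by
    refine MinTensor.ofSub_injective (core X) (core X) ?_
    rw [ofSub_freeComul, ← coe_coreOfFree, hx, map_zero]
    exact map_zero (comul X)

theorem ofSub_coreComul (x : core X) :
    comul X (x : QPerm X) = MinTensor.ofSub (core X) (core X) (coreComul X x) := by
  obtain ⟨x, rfl⟩ := coreOfFree_surjective x
  rw [coreComul, descend_apply, ofSub_freeComul, coe_coreOfFree]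

theorem coreComul_gen (i j : X) : coreComul X (gen i j) = ∑ k, gen i k ⊗ₜ[ℂ] gen k j := by
  rw [← coreOfFree_X (i, j), coreComul, descend_apply]
  exact FreeStarAlgebra.lift_X _ _ _

variable (X) in
/-- The counit `a i j ↦ δ i j` of `core X`. -/
def counit [DecidableEq X] : core X →⋆ₐ[ℂ] ℂ := (char 1).comp (core X).subtype

theorem counit_gen [DecidableEq X] (i j : X) : counit X (gen i j) = if i = j then 1 else 0 :=
  (char_a 1 i j).trans (by simp only [Equiv.Perm.one_apply, eq_comm])

variable (X) in
/-- The anti-automorphism `a i j ↦ a j i` of `QPerm X`. -/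
def opAntipode : QPerm X →⋆ₐ[ℂ] (QPerm X)ᵐᵒᵖ := lift _ isMagic_a.op_transpose

theorem opAntipode_a (i j : X) : opAntipode X (a i j) = MulOpposite.op (a j i) := lift_a _ _ i j

theorem unop_opAntipode_mem (x : core X) : (opAntipode X (x : QPerm X)).unop ∈ core X := by
  induction x using core_induction with
  | h₀ c =>
    have : ((algebraMap ℂ (core X) c : core X) : QPerm X) = algebraMap ℂ (QPerm X) c := rfl
    rw [this, AlgHomClass.commutes]
    exact algebraMap_mem (core X) c
  | h₁ i j => rw [coe_gen, opAntipode_a]; exact (gen j i).2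
  | h₂ x y hx hy => rw [MulMemClass.coe_mul, map_mul, MulOpposite.unop_mul]; exact mul_mem hy hx
  | h₃ x y hx hy => rw [AddMemClass.coe_add, map_add, MulOpposite.unop_add]; exact add_mem hx hy

variable (X) in
/-- The antipode `a i j ↦ a j i` of `core X`. -/
def antipode : core X →ₗ[ℂ] core X where
  toFun x := ⟨(opAntipode X (x : QPerm X)).unop, unop_opAntipode_mem x⟩
  map_add' x y := Subtype.ext <| by
    change (opAntipode X ((x : QPerm X) + y)).unop = _
    rw [map_add]; rfl
  map_smul' c x := Subtype.ext <| by
    change (opAntipode X (c • (x : QPerm X))).unop = _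
    rw [map_smul]; rfl

theorem antipode_gen (i j : X) : antipode X (gen i j) = gen j i :=
  Subtype.ext (congrArg MulOpposite.unop (opAntipode_a i j))

theorem antipode_mul (x y : core X) : antipode X (x * y) = antipode X y * antipode X x :=
  Subtype.ext (congrArg MulOpposite.unop (map_mul (opAntipode X) (x : QPerm X) y))

theorem antipode_algebraMap (c : ℂ) : antipode X (algebraMap ℂ _ c) = algebraMap ℂ _ c :=
  Subtype.ext (congrArg MulOpposite.unop (AlgHomClass.commutes (opAntipode X) c))

theorem antipode_antipode (x : core X) : antipode X (antipode X x) = x := by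
  induction x using core_induction with
  | h₀ c => rw [antipode_algebraMap, antipode_algebraMap]
  | h₁ i j => rw [antipode_gen, antipode_gen]
  | h₂ x y hx hy => rw [antipode_mul, antipode_mul, hx, hy]
  | h₃ x y hx hy => rw [map_add, map_add, hx, hy]

/-- This reduces the antipode identity for a product `x * y` to those for `x` and `y`: the inner
factor becomes the scalar `counit x`, which moves out. -/
theorem mul_rTensor_antipode (z : core X ⊗[ℂ] core X) (c d : core X) :
    LinearMap.mul' ℂ _ ((antipode X).rTensor _ (z * c ⊗ₜ[ℂ] d)) =
      antipode X c * LinearMap.mul' ℂ _ ((antipode X).rTensor _ z) * d := by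
  induction z with
  | zero => simp
  | add x y hx hy => simp only [add_mul, mul_add, map_add, hx, hy]
  | tmul a b => simp [antipode_mul, mul_assoc]

theorem mul_lTensor_antipode (z : core X ⊗[ℂ] core X) (c d : core X) :
    LinearMap.mul' ℂ _ ((antipode X).lTensor _ (c ⊗ₜ[ℂ] d * z)) =
      c * LinearMap.mul' ℂ _ ((antipode X).lTensor _ z) * antipode X d := by
  induction z with
  | zero => simp
  | add x y hx hy => simp only [add_mul, mul_add, map_add, hx, hy]
  | tmul a b => simp [antipode_mul, mul_assoc]

theorem antipode_left [DecidableEq X] (x : core X) :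
    LinearMap.mul' ℂ _ ((antipode X).rTensor _ (coreComul X x)) =
      algebraMap ℂ _ (counit X x) := by
  induction x using core_induction with
  | h₀ c =>
    rw [AlgHomClass.commutes (coreComul X), AlgHomClass.commutes (counit X),
      Algebra.TensorProduct.algebraMap_apply,
      LinearMap.rTensor_tmul, antipode_algebraMap, LinearMap.mul'_apply, mul_one]
    rfl
  | h₁ i j =>
    rw [coreComul_gen, counit_gen]
    simp only [map_sum, LinearMap.rTensor_tmul, LinearMap.mul'_apply, antipode_gen, gen_row_mul]
    split_ifs <;> simp [sum_gen_col]
  | h₂ x y hx hy =>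
    have key : ∀ w : core X ⊗[ℂ] core X,
        LinearMap.mul' ℂ _ ((antipode X).rTensor _ (coreComul X x * w)) =
          algebraMap ℂ _ (counit X x) * LinearMap.mul' ℂ _ ((antipode X).rTensor _ w) := by
      intro w
      induction w with
      | zero => simp
      | add x y hx hy => simp only [mul_add, map_add, hx, hy]
      | tmul c d =>
        rw [mul_rTensor_antipode, hx, ← Algebra.commutes, mul_assoc]
        simp
    rw [map_mul, key, hy, map_mul, map_mul]
  | h₃ x y hx hy => simp only [map_add, hx, hy]

theorem antipode_right [DecidableEq X] (x : core X) :
    LinearMap.mul' ℂ _ ((antipode X).lTensor _ (coreComul X x)) =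
      algebraMap ℂ _ (counit X x) := by
  induction x using core_induction with
  | h₀ c =>
    rw [AlgHomClass.commutes (coreComul X), AlgHomClass.commutes (counit X),
      Algebra.TensorProduct.algebraMap_apply,
      LinearMap.lTensor_tmul, ← map_one (algebraMap ℂ (core X)), antipode_algebraMap,
      LinearMap.mul'_apply, map_one, mul_one]
    rfl
  | h₁ i j =>
    rw [coreComul_gen, counit_gen]
    simp only [map_sum, LinearMap.lTensor_tmul, LinearMap.mul'_apply, antipode_gen, gen_col_mul]
    split_ifs <;> simp [sum_gen_row]
  | h₂ x y hx hy =>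
    have key : ∀ w : core X ⊗[ℂ] core X,
        LinearMap.mul' ℂ _ ((antipode X).lTensor _ (w * coreComul X y)) =
          algebraMap ℂ _ (counit X y) * LinearMap.mul' ℂ _ ((antipode X).lTensor _ w) := by
      intro w
      induction w with
      | zero => simp
      | add x y hx hy => simp only [add_mul, mul_add, map_add, hx, hy]
      | tmul c d =>
        rw [mul_lTensor_antipode, hy, ← Algebra.commutes, mul_assoc]
        simp
    rw [map_mul, key, hx, map_mul, map_mul, ← map_mul, mul_comm, map_mul]
  | h₃ x y hx hy => simp only [map_add, hx, hy]

theorem coreComul_coassoc (x : core X) :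
    TensorProduct.assoc ℂ (core X) (core X) (core X)
      ((coreComul X).toAlgHom.toLinearMap.rTensor (core X) (coreComul X x)) =
    (coreComul X).toAlgHom.toLinearMap.lTensor (core X) (coreComul X x) := by
  have h : ((Algebra.TensorProduct.assoc ℂ ℂ ℂ (core X) (core X) (core X)).toAlgHom.comp
      (Algebra.TensorProduct.map (coreComul X).toAlgHom (AlgHom.id ℂ _))).comp
        (coreComul X).toAlgHom =
      (Algebra.TensorProduct.map (AlgHom.id ℂ _) (coreComul X).toAlgHom).comp
        (coreComul X).toAlgHom := by
    refine core_hom_ext fun i j => ?_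
    simp [coreComul_gen, TensorProduct.sum_tmul, TensorProduct.tmul_sum]
    exact Finset.sum_comm
  exact DFunLike.congr_fun h x

theorem counit_rTensor [DecidableEq X] (x : core X) :
    (counit X).toAlgHom.toLinearMap.rTensor (core X) (coreComul X x) = 1 ⊗ₜ[ℂ] x := by
  have h : (Algebra.TensorProduct.map (counit X).toAlgHom (AlgHom.id ℂ _)).comp
        (coreComul X).toAlgHom = Algebra.TensorProduct.includeRight := by
    refine core_hom_ext fun i j => ?_
    simp [coreComul_gen, counit_gen, TensorProduct.ite_tmul]
  exact DFunLike.congr_fun h x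

theorem counit_lTensor [DecidableEq X] (x : core X) :
    (counit X).toAlgHom.toLinearMap.lTensor (core X) (coreComul X x) = x ⊗ₜ[ℂ] 1 := by
  have h : (Algebra.TensorProduct.map (AlgHom.id ℂ _) (counit X).toAlgHom).comp
        (coreComul X).toAlgHom = Algebra.TensorProduct.includeLeft := by
    refine core_hom_ext fun i j => ?_
    simp [coreComul_gen, counit_gen, TensorProduct.tmul_ite]
  exact DFunLike.congr_fun h x

variable (X) in
/-- The quantum permutation group of `X`. -/
def quantumGroup [DecidableEq X] : CompactQuantumGroup (QPerm X) where
  comul := comul X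
  core := core X
  dense_core := dense_core
  hopf :=
    { comul := coreComul X
      counit := counit X
      antipode := antipode X
      coassoc := coreComul_coassoc
      counit_left := counit_rTensor
      counit_right := counit_lTensor
      antipode_left := antipode_left
      antipode_right := antipode_right }
  comul_core := ofSub_coreComul
  full := core_full

end QPerm

/-! ### Coactions with orthogonal rows have column sums `1` -/

section ColumnSums

theorem inner_projection {A H : Type u} [CStarAlgebra A] [NormedAddCommGroup H]
    [InnerProductSpace ℂ H] [CompleteSpace H] (π : A →⋆ₐ[ℂ] (H →L[ℂ] H)) {p : A}
    (hp : p * p = p) (hs : star p = p) (ξ : H) : ⟪ξ, π p ξ⟫_ℂ = ((‖π p ξ‖ ^ 2 : ℝ) : ℂ) := by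
  have h1 : π p ξ = ContinuousLinearMap.adjoint (π p) (π p ξ) := by
    rw [← ContinuousLinearMap.star_eq_adjoint, ← StarHomClass.map_star, hs]
    change _ = (π p * π p) ξ
    rw [← map_mul, hp]
  rw [h1, ContinuousLinearMap.adjoint_inner_right, ← h1, inner_self_eq_norm_sq_to_K]
  simp

variable {A : Type u} [CStarAlgebra A] {X : Type u} [Fintype X]

/-- Let `s j` be the column sums of a matrix `u` of projections. A vector state norming a column sum
`s k` of maximal norm, tensored with an arbitrary vector state, is bounded by `‖s k‖` on
`∑ i, s i ⊗ u i j`. On vectors in the range of `u k j` the `k`-th summand already reaches this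
bound, and the other summands are nonnegative with positive coefficients, so they vanish. -/
theorem mul_eq_zero_of_norm_colSum_le {u : X → X → A} (hu : ∀ i j, u i j * u i j = u i j)
    (hs : ∀ i j, star (u i j) = u i j) (Φ : A →⋆ₐ[ℂ] A ⊗ₘ A)
    (hΦ : ∀ j, Φ (∑ i, u i j) = MinTensor.of (∑ l, (∑ i, u i l) ⊗ₜ[ℂ] u l j))
    {t : X → A} (ht : ∀ j, t j * ∑ i, u i j = 1) {k : X}
    (hk : ∀ j, ‖∑ i, u i j‖ ≤ ‖∑ i, u i k‖) {i : X} (hik : i ≠ k) (j : X) :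
    u i j * u k j = 0 := by
  classical
  by_contra h0
  let _ := CStarAlgebra.spectralOrder A
  have := CStarAlgebra.spectralOrderedRing A
  have hpos : 0 ≤ ∑ i, u i k := Finset.sum_nonneg fun i _ => by
    rw [← hu, ← congrArg (· * u i k) (hs i k)]
    exact star_mul_self_nonneg _
  have hne : ∑ i, u i k ≠ 0 := fun h => h0 <| by
    have h1 := ht k
    rw [h, mul_zero] at h1
    rw [← one_mul (u i j * _), ← h1, zero_mul]
  obtain ⟨H, _, _, _, π, ξ, hξ, hπ⟩ := CStarAlgebra.exists_representation hpos hne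
  obtain ⟨K, _, _, _, ρ, hρ⟩ := CStarAlgebra.exists_representation_ne_zero h0
  obtain ⟨η', hη'⟩ : ∃ η', ρ (u i j * u k j) η' ≠ 0 := by
    by_contra! h
    exact hρ (ContinuousLinearMap.ext h)
  let v : X → ℝ := fun l => ∑ i, ‖π (u i l) ξ‖ ^ 2
  have hv : ∀ l, ⟪ξ, π (∑ i, u i l) ξ⟫_ℂ = (v l : ℂ) := fun l => by
    rw [map_sum, sum_apply, inner_sum, Complex.ofReal_sum]
    exact Finset.sum_congr rfl fun i _ => inner_projection π (hu i l) (hs i l) ξ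
  have hv0 : ∀ l, 0 ≤ v l := fun l => Finset.sum_nonneg fun i _ => sq_nonneg _
  have hvpos : ∀ l, 0 < v l := fun l => by
    refine (hv0 l).lt_of_ne fun h => ?_
    have h1 : ∀ i, π (u i l) ξ = 0 := fun i => by
      have := (Finset.sum_eq_zero_iff_of_nonneg fun i _ => sq_nonneg _).1 h.symm i
        (Finset.mem_univ i)
      simpa using this
    have h2 : π (t l * ∑ i, u i l) ξ = 0 := by
      rw [map_mul, mul_apply_eq_comp, map_sum, sum_apply,
        Finset.sum_eq_zero fun i _ => h1 i, map_zero]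
    rw [ht, map_one] at h2
    have h3 : ξ = 0 := h2
    rw [h3, norm_zero] at hξ
    exact zero_ne_one hξ
  have hvk : v k = ‖∑ i, u i k‖ := by
    rw [hv] at hπ
    exact_mod_cast hπ
  let η := ρ (u k j) η'
  have hη : ρ (u k j) η = η := by
    change (ρ (u k j) * ρ (u k j)) η' = _
    rw [← map_mul, hu]
  have hη2 : ρ (u i j) η ≠ 0 := by
    rw [map_mul] at hη'
    exact hη'
  have hsum : ⟪HilbertTensor.of (ξ ⊗ₜ[ℂ] η),
      repTensor π ρ (∑ l, (∑ i, u i l) ⊗ₜ[ℂ] u l j) (HilbertTensor.of (ξ ⊗ₜ[ℂ] η))⟫_ℂ =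
      ((∑ l, v l * ‖ρ (u l j) η‖ ^ 2 : ℝ) : ℂ) := by
    rw [inner_repTensor, map_sum, map_sum, Complex.ofReal_sum]
    refine Finset.sum_congr rfl fun l _ => ?_
    rw [TensorProduct.map_tmul, LinearMap.mul'_apply, matrixCoeff_apply, matrixCoeff_apply, hv,
      inner_projection ρ (hu l j) (hs l j), Complex.ofReal_mul]
  have hle : ∑ l, v l * ‖ρ (u l j) η‖ ^ 2 ≤ v k * ‖η‖ ^ 2 := by
    have h1 : ‖HilbertTensor.of (ξ ⊗ₜ[ℂ] η)‖ = ‖η‖ := by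
      rw [LinearIsometry.norm_map, TensorProduct.norm_tmul, hξ, one_mul]
    have h2 : ‖repTensor π ρ (∑ l, (∑ i, u i l) ⊗ₜ[ℂ] u l j)‖ ≤ v k := by
      refine (norm_repTensor_le π ρ _).trans ?_
      rw [← hΦ, hvk]
      exact (NonUnitalStarAlgHom.norm_apply_le Φ _).trans (hk j)
    have h3 := norm_inner_le_norm (𝕜 := ℂ) (HilbertTensor.of (ξ ⊗ₜ[ℂ] η))
      (repTensor π ρ (∑ l, (∑ i, u i l) ⊗ₜ[ℂ] u l j) (HilbertTensor.of (ξ ⊗ₜ[ℂ] η)))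
    have h4 := ContinuousLinearMap.le_of_opNorm_le _ h2 (HilbertTensor.of (ξ ⊗ₜ[ℂ] η))
    rw [hsum, Complex.norm_real, h1] at h3
    rw [h1] at h4
    calc _ ≤ _ := Real.le_norm_self _
      _ ≤ _ := h3
      _ ≤ ‖η‖ * (v k * ‖η‖) := mul_le_mul_of_nonneg_left h4 (norm_nonneg _)
      _ = _ := by ring
  have hge : v k * ‖η‖ ^ 2 + v i * ‖ρ (u i j) η‖ ^ 2 ≤ ∑ l, v l * ‖ρ (u l j) η‖ ^ 2 := by
    rw [← Finset.add_sum_erase _ _ (Finset.mem_univ k), hη]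
    exact add_le_add_right (Finset.single_le_sum (f := fun l => v l * ‖ρ (u l j) η‖ ^ 2)
      (fun l _ => mul_nonneg (hv0 l) (sq_nonneg _))
      (Finset.mem_erase.2 ⟨hik, Finset.mem_univ i⟩)) _
  have := mul_pos (hvpos i) (pow_pos (norm_pos_iff.2 hη2) 2)
  linarith

/-- A matrix of coefficients of a coaction of the compact quantum group `G` on the functions on `X`:
a corepresentation by projections with orthogonal rows that sum to `1`. -/
structure CompactQuantumGroup.IsRowMagic [DecidableEq X] (G : CompactQuantumGroup A)
    (m : X → X → G.core) : Prop where
  row_mul : ∀ i j k, m i j * m i k = if j = k then m i j else 0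
  star_eq : ∀ i j, star (m i j) = m i j
  row : ∀ i, ∑ j, m i j = 1
  comul : ∀ i j, G.hopf.comul (m i j) = ∑ k, m i k ⊗ₜ[ℂ] m k j
  counit : ∀ i j, G.hopf.counit (m i j) = if i = j then 1 else 0

namespace CompactQuantumGroup.IsRowMagic

variable [DecidableEq X] {G : CompactQuantumGroup A} {m : X → X → G.core}

theorem antipode_mul (h : G.IsRowMagic m) (i j : X) :
    ∑ k, G.hopf.antipode (m i k) * m k j = if i = j then 1 else 0 := by
  have := G.hopf.antipode_left (m i j)
  rw [h.comul, h.counit] at this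
  simp only [map_sum, LinearMap.rTensor_tmul, LinearMap.mul'_apply] at this
  rw [this]
  split_ifs <;> simp

theorem mul_antipode (h : G.IsRowMagic m) (i j : X) :
    ∑ k, m i k * G.hopf.antipode (m k j) = if i = j then 1 else 0 := by
  have := G.hopf.antipode_right (m i j)
  rw [h.comul, h.counit] at this
  simp only [map_sum, LinearMap.lTensor_tmul, LinearMap.mul'_apply] at this
  rw [this]
  split_ifs <;> simp

theorem colSum_mul_antipode (h : G.IsRowMagic m) (i j : X) :
    (∑ k, m k i) * G.hopf.antipode (m i j) = m j i := by
  have h1 : ∀ l, ∑ k, m k i * m k l = if i = l then ∑ k, m k i else 0 := fun l => by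
    simp only [h.row_mul]
    split_ifs <;> simp
  calc _ = ∑ l, (∑ k, m k i * m k l) * G.hopf.antipode (m l j) := by simp [h1, ite_mul]
    _ = ∑ k, m k i * ∑ l, m k l * G.hopf.antipode (m l j) := by
      simp only [Finset.sum_mul, Finset.mul_sum, mul_assoc]
      exact Finset.sum_comm
    _ = _ := by simp [h.mul_antipode]

/-- The column sums are invertible. -/
theorem inv_mul_colSum (h : G.IsRowMagic m) (i : X) :
    (∑ k, G.hopf.antipode (m i k) * star (G.hopf.antipode (m i k))) * ∑ k, m k i = 1 := by
  have h1 : (∑ k, m k i) * (∑ k, G.hopf.antipode (m i k) * star (G.hopf.antipode (m i k))) = 1 := by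
    rw [Finset.mul_sum]
    simp only [← mul_assoc, h.colSum_mul_antipode]
    have := congrArg star (h.antipode_mul i i)
    simpa [star_sum, star_mul, h.star_eq] using this
  have := congrArg star h1
  simpa [star_sum, star_mul, h.star_eq] using this

/-- The operation `x ↦ star (antipode (star x))` inverts the antipode on matrix coefficients. -/
theorem star_antipode_star_antipode (h : G.IsRowMagic m) (i j : X) :
    star (G.hopf.antipode (star (G.hopf.antipode (m i j)))) = m i j := by
  let U : Matrix X X G.core := Matrix.of m
  let V : Matrix X X G.core := Matrix.of fun i j => G.hopf.antipode (m i j)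
  let W : Matrix X X G.core :=
    Matrix.of fun i j => star (G.hopf.antipode (star (G.hopf.antipode (m i j))))
  have hVU : V * U = 1 := by
    ext1 i j
    rw [Matrix.mul_apply, Matrix.one_apply]
    exact h.antipode_mul i j
  have hUV : U * V = 1 := by
    ext1 i j
    rw [Matrix.mul_apply, Matrix.one_apply]
    exact h.mul_antipode i j
  -- the comultiplication of `V` is found by inverting that of `U`
  have hcomul : ∀ i j, G.hopf.comul (G.hopf.antipode (m i j)) =
      ∑ k, G.hopf.antipode (m k j) ⊗ₜ[ℂ] G.hopf.antipode (m i k) := by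
    let Δ : G.core →+* G.core ⊗[ℂ] G.core := (G.hopf.comul : G.core →+* G.core ⊗[ℂ] G.core)
    let ι₁ : G.core →+* G.core ⊗[ℂ] G.core :=
      (Algebra.TensorProduct.includeLeft : G.core →ₐ[ℂ] G.core ⊗[ℂ] G.core).toRingHom
    let ι₂ : G.core →+* G.core ⊗[ℂ] G.core :=
      (Algebra.TensorProduct.includeRight : G.core →ₐ[ℂ] G.core ⊗[ℂ] G.core).toRingHom
    have hU : Δ.mapMatrix U = ι₁.mapMatrix U * ι₂.mapMatrix U := by
      ext1 i j
      rw [Matrix.mul_apply]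
      refine (h.comul i j).trans (Finset.sum_congr rfl fun k _ => ?_)
      change _ = (m i k ⊗ₜ[ℂ] 1) * (1 ⊗ₜ[ℂ] m k j)
      simp
    have h1 : (ι₂.mapMatrix V * ι₁.mapMatrix V) * Δ.mapMatrix U = 1 := by
      rw [hU, mul_assoc, ← mul_assoc (ι₁.mapMatrix V), ← map_mul, hVU, map_one, one_mul, ← map_mul,
        hVU, map_one]
    have h2 : Δ.mapMatrix U * Δ.mapMatrix V = 1 := by rw [← map_mul, hUV, map_one]
    have h3 := left_inv_eq_right_inv h1 h2
    intro i j
    have h4 := congrFun (congrFun h3 i) j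
    rw [Matrix.mul_apply] at h4
    refine h4.symm.trans (Finset.sum_congr rfl fun k _ => ?_)
    change (1 ⊗ₜ[ℂ] G.hopf.antipode (m i k)) * (G.hopf.antipode (m k j) ⊗ₜ[ℂ] 1) = _
    simp
  have hcounit : ∀ i j, G.hopf.counit (G.hopf.antipode (m i j)) = if i = j then 1 else 0 := by
    let ε : G.core →+* ℂ := (G.hopf.counit : G.core →+* ℂ)
    have h1 : ε.mapMatrix V * ε.mapMatrix U = 1 := by rw [← map_mul, hVU, map_one]
    have h2 : ε.mapMatrix U = 1 := by
      ext1 i j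
      rw [Matrix.one_apply]
      exact h.counit i j
    rw [h2, mul_one] at h1
    intro i j
    rw [← Matrix.one_apply, ← h1]
    rfl
  have hVW : V * W = 1 := by
    ext1 i j
    rw [Matrix.mul_apply, Matrix.one_apply]
    have h1 := G.hopf.antipode_left (star (G.hopf.antipode (m i j)))
    rw [StarHomClass.map_star G.hopf.comul, StarHomClass.map_star G.hopf.counit, hcomul,
      hcounit] at h1
    simp only [star_sum, TensorProduct.star_tmul, map_sum, LinearMap.rTensor_tmul,
      LinearMap.mul'_apply] at h1
    have h2 := congrArg star h1
    simp only [star_sum, star_mul, star_star] at h2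
    refine h2.trans ?_
    split_ifs <;> simp
  have hUW : U = W := left_inv_eq_right_inv hUV hVW
  exact (congrFun (congrFun hUW i) j).symm

/-- If a column sum of `m` has the largest norm, then it is `1`. -/
theorem colSum_eq_one_of_norm_le (h : G.IsRowMagic m) {k : X}
    (hk : ∀ j, ‖∑ i, (m i j : A)‖ ≤ ‖∑ i, (m i k : A)‖) : ∑ i, m i k = 1 := by
  -- row `k` is orthogonal to the other rows
  have horth : ∀ i j, i ≠ k → m i j * m k j = 0 := fun i j hik => by
    refine Subtype.ext (mul_eq_zero_of_norm_colSum_le (u := fun i j => (m i j : A))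
      (fun i j => ?_) (fun i j => ?_) G.comul (fun j => ?_)
      (t := fun i => ((∑ k, G.hopf.antipode (m i k) * star (G.hopf.antipode (m i k)) : G.core) : A))
      (fun j => ?_) hk hik j)
    · exact congrArg Subtype.val ((h.row_mul i j j).trans (if_pos rfl))
    · exact congrArg Subtype.val (h.star_eq i j)
    · have h1 : G.hopf.comul (∑ i, m i j) = ∑ l, (∑ i, m i l) ⊗ₜ[ℂ] m l j := by
        simp only [map_sum, h.comul, TensorProduct.sum_tmul]
        exact Finset.sum_comm
      have h2 := G.comul_core (∑ i, m i j)
      rw [h1, AddSubmonoidClass.coe_finsetSum] at h2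
      rw [h2, MinTensor.ofSub, LinearMap.comp_apply, map_sum]
      refine congrArg _ (Finset.sum_congr rfl fun l _ => ?_)
      rw [TensorProduct.map_tmul]
      exact congrArg (· ⊗ₜ[ℂ] (m l j : A)) (AddSubmonoidClass.coe_finsetSum _ _)
    · have := congrArg Subtype.val (h.inv_mul_colSum j)
      rw [MulMemClass.coe_mul, AddSubmonoidClass.coe_finsetSum (fun k => m k j)] at this
      exact this
  have hfix : ∀ j, (∑ i, m i j) * m k j = m k j := fun j => by
    rw [Finset.sum_mul, Finset.sum_eq_single k (fun i _ hik => horth i j hik) (by simp), h.row_mul,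
      if_pos rfl]
  have hanti : ∀ j, G.hopf.antipode (m j k) = m k j := fun j => by
    rw [← one_mul (G.hopf.antipode _), ← h.inv_mul_colSum j, mul_assoc, h.colSum_mul_antipode]
    nth_rw 1 [← hfix j]
    rw [← mul_assoc, h.inv_mul_colSum, one_mul]
  have hone : G.hopf.antipode 1 = 1 := by
    have := G.hopf.antipode_left 1
    rw [map_one G.hopf.comul, map_one G.hopf.counit, Algebra.TensorProduct.one_def] at this
    simpa using this
  calc ∑ i, m i k = ∑ i, star (G.hopf.antipode (star (G.hopf.antipode (m i k)))) := by
        simp only [h.star_antipode_star_antipode]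
    _ = star (G.hopf.antipode (star (∑ i, m k i))) := by simp only [hanti, star_sum, map_sum]
    _ = 1 := by rw [h.row, star_one, hone, star_one]

/-- A coaction on the functions on `X` is given by a magic unitary: all column sums have norm at
most `1`, and their total is the number of rows. -/
theorem isMagic (h : G.IsRowMagic m) : IsMagic fun i j => (m i j : A) where
  idem i j := congrArg Subtype.val ((h.row_mul i j j).trans (if_pos rfl))
  star_eq i j := congrArg Subtype.val (h.star_eq i j)
  row i := (AddSubmonoidClass.coe_finsetSum _ _).symm.trans (congrArg Subtype.val (h.row i))
  col j := by
    have : Nonempty X := ⟨j⟩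
    let _ := CStarAlgebra.spectralOrder A
    have := CStarAlgebra.spectralOrderedRing A
    obtain ⟨k, hk⟩ := Finite.exists_max fun j => ‖∑ i, (m i j : A)‖
    have hk1 : ∑ i, (m i k : A) = 1 :=
      (AddSubmonoidClass.coe_finsetSum _ _).symm.trans
        (congrArg Subtype.val (h.colSum_eq_one_of_norm_le hk))
    have hle : ∀ j, 0 ≤ 1 - ∑ i, (m i j : A) := fun j => by
      have hpos : 0 ≤ ∑ i, (m i j : A) := Finset.sum_nonneg fun i _ => by
        have h1 : (m i j : A) = star (m i j : A) * m i j := by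
          rw [← StarMemClass.coe_star, h.star_eq]
          exact congrArg Subtype.val ((h.row_mul i j j).trans (if_pos rfl)).symm
        rw [h1]
        exact star_mul_self_nonneg _
      refine sub_nonneg.2 ((CStarAlgebra.norm_le_one_iff_of_nonneg _ hpos).1 ((hk j).trans ?_))
      rw [hk1]
      rcases subsingleton_or_nontrivial A with hA | hA
      · simp [Subsingleton.elim (1 : A) 0]
      · simp
    have hsum : ∑ j, (1 - ∑ i, (m i j : A)) = 0 := by
      rw [Finset.sum_sub_distrib, Finset.sum_comm, sub_eq_zero]
      refine Finset.sum_congr rfl fun i _ => ?_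
      exact ((AddSubmonoidClass.coe_finsetSum _ _).symm.trans (congrArg Subtype.val (h.row i))).symm
    have := (Finset.sum_eq_zero_iff_of_nonneg fun j _ => hle j).1 hsum j (Finset.mem_univ j)
    exact (sub_eq_zero.1 this).symm

end CompactQuantumGroup.IsRowMagic

end ColumnSums

/-! ### Actions on the algebra of functions on a finite set -/

/-- Orthogonal projections that sum to `1`. -/
structure IsPartitionOfUnity {X : Type*} [Fintype X] [DecidableEq X] {R : Type*} [Ring R]
    [StarRing R] (p : X → R) : Prop where
  mul_eq : ∀ i j, p i * p j = if i = j then p i else 0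
  star_eq : ∀ i, star (p i) = p i
  sum_eq : ∑ i, p i = 1

namespace IsPartitionOfUnity

variable {X : Type*} [Fintype X] [DecidableEq X] {R : Type*} [Ring R] [StarRing R]
  [Algebra ℂ R] [StarModule ℂ R] {p : X → R}

/-- The *-homomorphism `b ↦ ∑ j, b j • p j` from the functions on `X`. -/
def hom (hp : IsPartitionOfUnity p) : (X → ℂ) →⋆ₐ[ℂ] R where
  toFun b := ∑ j, b j • p j
  map_one' := by simp [hp.sum_eq]
  map_mul' b c := by simp [Finset.sum_mul, Finset.mul_sum, hp.mul_eq, smul_smul, mul_comm]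
  map_zero' := by simp
  map_add' b c := by simp [add_smul, Finset.sum_add_distrib]
  commutes' c := by simp [← Finset.smul_sum, hp.sum_eq, Algebra.algebraMap_eq_smul_one]
  map_star' b := by simp [star_sum, hp.star_eq]

theorem hom_apply (hp : IsPartitionOfUnity p) (b : X → ℂ) : hp.hom b = ∑ j, b j • p j := rfl

theorem hom_single (hp : IsPartitionOfUnity p) (j : X) : hp.hom (Pi.single j 1) = p j := by
  simp [hom_apply, Pi.single_apply]

/-- The *-homomorphism `c ↦ ∑ i, p i ⊗ r i c`. -/
def tensorHom {C R' : Type*} [Ring C] [StarRing C] [Algebra ℂ C] [Ring R'] [StarRing R']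
    [Algebra ℂ R'] [StarModule ℂ R'] (hp : IsPartitionOfUnity p) (r : X → C →⋆ₐ[ℂ] R') :
    C →⋆ₐ[ℂ] R ⊗[ℂ] R' where
  toFun c := ∑ i, p i ⊗ₜ[ℂ] r i c
  map_one' := by
    simp [← TensorProduct.sum_tmul, hp.sum_eq, Algebra.TensorProduct.one_def]
  map_mul' b c := by
    simp [Finset.sum_mul, Finset.mul_sum, hp.mul_eq, TensorProduct.ite_tmul]
  map_zero' := by simp
  map_add' b c := by simp [TensorProduct.tmul_add, Finset.sum_add_distrib]
  commutes' c := by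
    simp [Algebra.algebraMap_eq_smul_one, ← Finset.smul_sum,
      ← TensorProduct.sum_tmul, hp.sum_eq, Algebra.TensorProduct.one_def]
  map_star' b := by simp [star_sum, hp.star_eq, StarHomClass.map_star]

end IsPartitionOfUnity

namespace FunctionAlgebra

section

variable {X : Type u} [Fintype X] [DecidableEq X]

theorem isPartitionOfUnity_single :
    IsPartitionOfUnity fun j : X => (Pi.single j 1 : X → ℂ) where
  mul_eq i j := by
    ext k
    split_ifs with h
    · simp [h, Pi.single_apply]
    · simp only [Pi.mul_apply, Pi.single_apply, Pi.zero_apply, mul_ite, mul_one, mul_zero]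
      split_ifs <;> simp_all
  star_eq i := by ext k; simp [Pi.single_apply, apply_ite star]
  sum_eq := by ext k; simp [Finset.sum_apply, Pi.single_apply]

variable {ℬ : StarSubalgebra ℂ (X → ℂ)}

/-- The minimal projections, as elements of the improper *-subalgebra. The latter is a variable `ℬ`
with `ℬ = ⊤`, the form in which the dense *-subalgebra of an action is given. -/
def topSingle (hℬ : ℬ = ⊤) (j : X) : ℬ := ⟨Pi.single j 1, hℬ ▸ trivial⟩

theorem isPartitionOfUnity_topSingle (hℬ : ℬ = ⊤) : IsPartitionOfUnity (topSingle hℬ) where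
  mul_eq i j := Subtype.ext <|
    (isPartitionOfUnity_single.mul_eq i j).trans <| by split_ifs <;> rfl
  star_eq i := Subtype.ext (isPartitionOfUnity_single.star_eq i)
  sum_eq := Subtype.ext <| by
    rw [AddSubmonoidClass.coe_finsetSum]
    exact isPartitionOfUnity_single.sum_eq

/-- Evaluation at a point. -/
def ev (i : X) : ℬ →⋆ₐ[ℂ] ℂ :=
  (Pi.evalStarAlgHom ℂ (fun _ : X => ℂ) i).comp ℬ.subtype

theorem ev_topSingle (hℬ : ℬ = ⊤) (i j : X) : ev i (topSingle hℬ j) = if i = j then 1 else 0 :=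
  Pi.single_apply j (1 : ℂ) i

theorem sum_ev_smul (hℬ : ℬ = ⊤) (b : ℬ) : ∑ i, ev i b • topSingle hℬ i = b := by
  refine Subtype.ext (funext fun k => ?_)
  rw [AddSubmonoidClass.coe_finsetSum, Finset.sum_apply]
  change ∑ i, (b : X → ℂ) i * (Pi.single i (1 : ℂ) : X → ℂ) k = _
  simp [Pi.single_apply]

theorem linearMap_ext {M : Type*} [AddCommGroup M] [Module ℂ M]
    (hℬ : ℬ = ⊤)
    {f g : ℬ →ₗ[ℂ] M} (h : ∀ j, f (topSingle hℬ j) = g (topSingle hℬ j)) : f = g := by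
  ext b
  rw [← sum_ev_smul hℬ b, map_sum, map_sum]
  exact Finset.sum_congr rfl fun i _ => by rw [map_smul, map_smul, h]

theorem eq_of_sum_tmul_eq {B M : Type*} [AddCommGroup B] [Module ℂ B] [AddCommGroup M]
    [Module ℂ M] {e : X → B} (f : X → B →ₗ[ℂ] ℂ) (hf : ∀ i j, f i (e j) = if i = j then 1 else 0)
    {x y : X → M} (h : ∑ i, e i ⊗ₜ[ℂ] x i = ∑ i, e i ⊗ₜ[ℂ] y i) : x = y := by
  funext k
  have := congrArg ((TensorProduct.lid ℂ M).toLinearMap ∘ₗ LinearMap.rTensor M (f k)) h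
  simpa [hf] using this

/-! Translation between the coaction identities for `δ` and the identities for the matrix `m` of
coefficients of `δ` with respect to a spanning family `e`. -/

section Coaction

omit [DecidableEq X]

variable {B C M : Type*} [Ring B] [StarRing B] [Algebra ℂ B] [StarModule ℂ B] [Ring C] [StarRing C]
  [Algebra ℂ C] [StarModule ℂ C] [Ring M] [StarRing M] [Algebra ℂ M]
  {δ : B →⋆ₐ[ℂ] B ⊗[ℂ] C} {e : X → B} {m : X → X → C}

theorem assoc_rTensor_sum (hδ : ∀ j, δ (e j) = ∑ i, e i ⊗ₜ[ℂ] m i j) (j : X) :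
    TensorProduct.assoc ℂ B C C (δ.toAlgHom.toLinearMap.rTensor C (δ (e j))) =
      ∑ i, e i ⊗ₜ[ℂ] ∑ k, m i k ⊗ₜ[ℂ] m k j := by
  have h : ∀ b, δ.toAlgHom.toLinearMap b = δ b := fun _ => rfl
  simp only [h, hδ, map_sum, LinearMap.rTensor_tmul, TensorProduct.sum_tmul,
    TensorProduct.assoc_tmul, TensorProduct.tmul_sum]
  exact Finset.sum_comm

theorem lTensor_sum (hδ : ∀ j, δ (e j) = ∑ i, e i ⊗ₜ[ℂ] m i j) (f : C →⋆ₐ[ℂ] M) (j : X) :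
    f.toAlgHom.toLinearMap.lTensor B (δ (e j)) = ∑ i, e i ⊗ₜ[ℂ] f (m i j) := by
  rw [hδ, map_sum]
  rfl

theorem coassoc_of_matrix (he : ∀ b : B, ∃ c : X → ℂ, ∑ i, c i • e i = b)
    (hδ : ∀ j, δ (e j) = ∑ i, e i ⊗ₜ[ℂ] m i j) {Δ : C →⋆ₐ[ℂ] C ⊗[ℂ] C}
    (hΔ : ∀ i j, Δ (m i j) = ∑ k, m i k ⊗ₜ[ℂ] m k j) (b : B) :
    TensorProduct.assoc ℂ B C C (δ.toAlgHom.toLinearMap.rTensor C (δ b)) =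
      Δ.toAlgHom.toLinearMap.lTensor B (δ b) := by
  obtain ⟨c, rfl⟩ := he b
  simp only [map_sum, map_smul, assoc_rTensor_sum hδ, lTensor_sum hδ, hΔ]

theorem counit_of_matrix [DecidableEq X] (he : ∀ b : B, ∃ c : X → ℂ, ∑ i, c i • e i = b)
    (hδ : ∀ j, δ (e j) = ∑ i, e i ⊗ₜ[ℂ] m i j) {ε : C →⋆ₐ[ℂ] ℂ}
    (hε : ∀ i j, ε (m i j) = if i = j then 1 else 0) (b : B) :
    ε.toAlgHom.toLinearMap.lTensor B (δ b) = b ⊗ₜ[ℂ] 1 := by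
  obtain ⟨c, rfl⟩ := he b
  simp only [map_sum, map_smul, lTensor_sum hδ, hε, TensorProduct.sum_tmul]
  simp [TensorProduct.tmul_ite, TensorProduct.smul_tmul']

theorem matrix_of_coassoc [DecidableEq X] (f : X → B →ₗ[ℂ] ℂ)
    (hf : ∀ i j, f i (e j) = if i = j then 1 else 0)
    (hδ : ∀ j, δ (e j) = ∑ i, e i ⊗ₜ[ℂ] m i j) {Δ : C →⋆ₐ[ℂ] C ⊗[ℂ] C}
    (h : ∀ b, TensorProduct.assoc ℂ B C C (δ.toAlgHom.toLinearMap.rTensor C (δ b)) =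
      Δ.toAlgHom.toLinearMap.lTensor B (δ b)) (i j : X) :
    Δ (m i j) = ∑ k, m i k ⊗ₜ[ℂ] m k j := by
  have h1 := h (e j)
  rw [assoc_rTensor_sum hδ, lTensor_sum hδ] at h1
  exact (congrFun (eq_of_sum_tmul_eq f hf h1) i).symm

theorem matrix_of_counit [DecidableEq X] (f : X → B →ₗ[ℂ] ℂ)
    (hf : ∀ i j, f i (e j) = if i = j then 1 else 0)
    (hδ : ∀ j, δ (e j) = ∑ i, e i ⊗ₜ[ℂ] m i j) {ε : C →⋆ₐ[ℂ] ℂ}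
    (h : ∀ b, ε.toAlgHom.toLinearMap.lTensor B (δ b) = b ⊗ₜ[ℂ] 1) (i j : X) :
    ε (m i j) = if i = j then 1 else 0 := by
  have h1 := h (e j)
  have h2 : e j ⊗ₜ[ℂ] (1 : ℂ) = ∑ i, e i ⊗ₜ[ℂ] (if i = j then (1 : ℂ) else 0) := by
    simp [TensorProduct.tmul_ite]
  rw [lTensor_sum hδ, h2] at h1
  exact congrFun (eq_of_sum_tmul_eq f hf h1) i

end Coaction

section Slice

variable {R : Type*} [Ring R] [StarRing R] [Algebra ℂ R] [StarModule ℂ R]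

/-- The slice map `b ⊗ x ↦ b i • x`. -/
def slice (i : X) : ℬ ⊗[ℂ] R →⋆ₐ[ℂ] R :=
  let φ := (Algebra.TensorProduct.lid ℂ R).toAlgHom.comp
      (Algebra.TensorProduct.map (ev i).toAlgHom (AlgHom.id ℂ R))
  { φ with
    map_star' := fun z => by
      change φ (star z) = star (φ z)
      induction z with
      | zero => simp
      | add x y hx hy => simp only [star_add, map_add, hx, hy]
      | tmul b x =>
        change ev i (star b) • star x = star (ev i b • x)
        rw [StarHomClass.map_star, star_smul] }

omit [DecidableEq X] in
theorem slice_tmul (i : X) (b : ℬ) (x : R) :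
    slice i (b ⊗ₜ[ℂ] x) = ev i b • x := rfl

theorem sum_topSingle_tmul_slice (hℬ : ℬ = ⊤) (z : ℬ ⊗[ℂ] R) :
    ∑ i, topSingle hℬ i ⊗ₜ[ℂ] slice i z = z := by
  induction z with
  | zero => simp
  | add x y hx hy =>
    simp only [map_add, TensorProduct.tmul_add, Finset.sum_add_distrib, hx, hy]
  | tmul b x =>
    simp only [slice_tmul, TensorProduct.tmul_smul]
    conv_rhs => rw [← sum_ev_smul hℬ b, TensorProduct.sum_tmul]
    rfl

end Slice

end

end FunctionAlgebra


open FunctionAlgebra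

namespace QPerm

variable {X : Type u} [Fintype X] [DecidableEq X]

theorem isPartitionOfUnity_a (i : X) : IsPartitionOfUnity (a i : X → QPerm X) where
  mul_eq := isMagic_a.row_mul i
  star_eq := isMagic_a.star_eq i
  sum_eq := isMagic_a.row i

theorem isPartitionOfUnity_gen (i : X) : IsPartitionOfUnity (gen i : X → core X) where
  mul_eq := gen_row_mul i
  star_eq := star_gen i
  sum_eq := sum_gen_row i

variable (X) in
/-- The action `e j ↦ ∑ i, e i ⊗ a i j` of the quantum permutation group. -/
def action : (X → ℂ) →⋆ₐ[ℂ] (X → ℂ) ⊗ₘ QPerm X :=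
  MinTensor.of.comp (isPartitionOfUnity_single.tensorHom fun i => (isPartitionOfUnity_a i).hom)

theorem action_single (j : X) :
    action X (Pi.single j 1) = ∑ i, MinTensor.tmul (Pi.single i 1) (a i j) := by
  change MinTensor.of (∑ i, _ ⊗ₜ[ℂ] _) = _
  simp only [IsPartitionOfUnity.hom_single, map_sum]
  rfl

/-- The algebraic coaction underlying `action X`. -/
def coaction {ℬ : StarSubalgebra ℂ (X → ℂ)} (hℬ : ℬ = ⊤) : ℬ →⋆ₐ[ℂ] ℬ ⊗[ℂ] core X :=
  (isPartitionOfUnity_topSingle hℬ).tensorHom fun i =>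
    (isPartitionOfUnity_gen i).hom.comp ℬ.subtype

theorem coaction_topSingle {ℬ : StarSubalgebra ℂ (X → ℂ)} (hℬ : ℬ = ⊤) (j : X) :
    coaction hℬ (topSingle hℬ j) = ∑ i, topSingle hℬ i ⊗ₜ[ℂ] gen i j :=
  Finset.sum_congr rfl fun i _ =>
    congrArg (topSingle hℬ i ⊗ₜ[ℂ] ·) ((isPartitionOfUnity_gen i).hom_single j)

theorem action_coe {ℬ : StarSubalgebra ℂ (X → ℂ)} (hℬ : ℬ = ⊤) (b : ℬ) :
    action X (b : X → ℂ) = MinTensor.ofSub ℬ (core X) (coaction hℬ b) := by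
  have h : (action X).toAlgHom.toLinearMap ∘ₗ ℬ.subtype.toAlgHom.toLinearMap =
      MinTensor.ofSub ℬ (core X) ∘ₗ (coaction hℬ).toAlgHom.toLinearMap := by
    refine linearMap_ext hℬ fun j => ?_
    change action X (Pi.single j 1) = MinTensor.ofSub ℬ (core X) (coaction hℬ (topSingle hℬ j))
    rw [action_single, coaction_topSingle, map_sum]
    rfl
  exact DFunLike.congr_fun h b

theorem coaction_coassoc {ℬ : StarSubalgebra ℂ (X → ℂ)} (hℬ : ℬ = ⊤) (b : ℬ) :
    TensorProduct.assoc ℂ ℬ (core X) (core X)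
      ((coaction hℬ).toAlgHom.toLinearMap.rTensor (core X) (coaction hℬ b)) =
    (coreComul X).toAlgHom.toLinearMap.lTensor ℬ (coaction hℬ b) :=
  coassoc_of_matrix (fun b => ⟨_, sum_ev_smul hℬ b⟩) (coaction_topSingle hℬ) coreComul_gen b

theorem coaction_counit {ℬ : StarSubalgebra ℂ (X → ℂ)} (hℬ : ℬ = ⊤) (b : ℬ) :
    (counit X).toAlgHom.toLinearMap.lTensor ℬ (coaction hℬ b) = b ⊗ₜ[ℂ] 1 :=
  counit_of_matrix (fun b => ⟨_, sum_ev_smul hℬ b⟩) (coaction_topSingle hℬ) counit_gen b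

theorem isAction_action : (quantumGroup X).IsAction (action X) :=
  ⟨⊤, coaction rfl, dense_univ, action_coe rfl, coaction_coassoc rfl, coaction_counit rfl⟩

end QPerm

/-- The matrix coefficients of an action on the functions on a finite set. -/
theorem CompactQuantumGroup.IsAction.exists_isRowMagic {X : Type u} [Fintype X] [DecidableEq X]
    {A : Type u} [CStarAlgebra A] {G : CompactQuantumGroup A} {α : (X → ℂ) →⋆ₐ[ℂ] (X → ℂ) ⊗ₘ A}
    (h : G.IsAction α) : ∃ m : X → X → G.core, G.IsRowMagic m ∧
      ∀ j, α (Pi.single j 1) = ∑ i, MinTensor.tmul (Pi.single i 1) (m i j : A) := by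
  obtain ⟨ℬ, δ, hd, hα, hco, hcu⟩ := h
  -- a dense subspace of a finite dimensional space is everything
  have hℬ : ℬ = ⊤ := by
    have hc : IsClosed (ℬ : Set (X → ℂ)) :=
      Submodule.closed_of_finiteDimensional (Subalgebra.toSubmodule ℬ.toSubalgebra)
    refine SetLike.coe_injective ?_
    rw [← hc.closure_eq, hd.closure_eq]
    rfl
  let m : X → X → G.core := fun i j => slice i (δ (topSingle hℬ j))
  have hδ : ∀ j, δ (topSingle hℬ j) = ∑ i, topSingle hℬ i ⊗ₜ[ℂ] m i j := fun j =>
    (sum_topSingle_tmul_slice hℬ _).symm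
  refine ⟨m, ⟨fun i j k => ?_, fun i j => ?_, fun i => ?_, fun i j => ?_, fun i j => ?_⟩,
    fun j => ?_⟩
  · change slice i (δ (topSingle hℬ j)) * slice i (δ (topSingle hℬ k)) = _
    rw [← map_mul, ← map_mul, (isPartitionOfUnity_topSingle hℬ).mul_eq]
    split_ifs
    · rfl
    · rw [map_zero, map_zero]
  · change star (slice i (δ (topSingle hℬ j))) = slice i (δ (topSingle hℬ j))
    rw [← StarHomClass.map_star, ← StarHomClass.map_star, (isPartitionOfUnity_topSingle hℬ).star_eq]
  · change ∑ j, slice i (δ (topSingle hℬ j)) = 1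
    rw [← map_sum, ← map_sum, (isPartitionOfUnity_topSingle hℬ).sum_eq, map_one, map_one]
  · exact matrix_of_coassoc (fun i => (ev i).toAlgHom.toLinearMap) (ev_topSingle hℬ) hδ hco i j
  · exact matrix_of_counit (fun i => (ev i).toAlgHom.toLinearMap) (ev_topSingle hℬ) hδ hcu i j
  · have h1 := hα (topSingle hℬ j)
    rw [hδ, map_sum] at h1
    exact h1

/-! ### Finality of the quantum permutation group -/

namespace QPerm

variable {X : Type u} [Fintype X] [DecidableEq X]

variable (X) in
/-- The quantum permutation group with its action on the functions on `X`. -/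
def transformationGroup : QuantumTransformationGroup (X → ℂ) :=
  ⟨QPerm X, quantumGroup X, action X, isAction_action⟩

/-- Finality: the morphism is given by the matrix of coefficients of the action of `S`, which is a
magic unitary, and this matrix is determined by the action. -/
theorem existsUnique_isMorphism (S : QuantumTransformationGroup (X → ℂ)) :
    ∃! π : QPerm X →⋆ₐ[ℂ] S.A,
      QuantumTransformationGroup.IsMorphism S (transformationGroup X) π := by
  obtain ⟨m, hm, hα⟩ := S.isAction.exists_isRowMagic
  refine ⟨lift _ hm.isMagic, ⟨fun x => ?_, fun b => ?_⟩, fun π hπ => hom_ext fun i j => ?_⟩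
  · have h : S.G.comul.comp (lift _ hm.isMagic) =
        (MinTensor.map (lift _ hm.isMagic) (lift _ hm.isMagic)).comp (comul X) := by
      refine hom_ext fun i j => ?_
      change S.G.comul (lift _ hm.isMagic (a i j)) = MinTensor.map _ _ (comul X (a i j))
      rw [lift_a, comul_a, S.G.comul_core, hm.comul, map_sum, map_sum]
      refine Finset.sum_congr rfl fun k _ => ?_
      rw [MinTensor.map_tmul, lift_a, lift_a]
      rfl
    exact DFunLike.congr_fun h x
  · have h : ∀ j, S.α (Pi.single j 1) = MinTensor.map (StarAlgHom.id ℂ (X → ℂ))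
        (lift _ hm.isMagic) (action X (Pi.single j 1)) := fun j => by
      rw [hα, action_single, map_sum]
      refine Finset.sum_congr rfl fun k _ => ?_
      rw [MinTensor.map_tmul, lift_a]
      rfl
    change S.α b = MinTensor.map (StarAlgHom.id ℂ (X → ℂ)) (lift _ hm.isMagic) (action X b)
    rw [pi_eq_sum_univ' b]
    simp only [map_sum, map_smul, h]
  · rw [lift_a]
    have h := hπ.2 (Pi.single j 1)
    change S.α _ = MinTensor.map (StarAlgHom.id ℂ (X → ℂ)) π (action X _) at h
    rw [hα, action_single, map_sum] at h
    have h1 := MinTensor.of_injective (a₁ := ∑ i, (Pi.single i 1 : X → ℂ) ⊗ₜ[ℂ] (m i j : S.A))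
      (a₂ := ∑ i, (Pi.single i 1 : X → ℂ) ⊗ₜ[ℂ] π (a i j)) <| by
        rw [map_sum, map_sum]
        refine h.trans (Finset.sum_congr rfl fun i _ => ?_)
        rw [MinTensor.map_tmul]
        rfl
    exact (congrFun (eq_of_sum_tmul_eq (fun i => LinearMap.proj i)
      (fun i j => Pi.single_apply j (1 : ℂ) i) h1) i).symm

/-! ### Characters -/

/-- The entries of a magic unitary over `ℂ` are those of a permutation matrix. -/
theorem exists_eq_char (χ : QPerm X →⋆ₐ[ℂ] ℂ) : ∃ σ, char σ = χ := by
  have hm := isMagic_a.map χ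
  have h01 : ∀ i j, χ (a i j) = 0 ∨ χ (a i j) = 1 := fun i j => by
    have := hm.idem i j
    rcases eq_or_ne (χ (a i j)) 0 with h | h
    · exact .inl h
    · exact .inr (mul_left_cancel₀ h (by simpa using this))
  have hex : ∀ j, ∃ i, χ (a i j) = 1 := fun j => by
    by_contra! h
    have h0 := hm.col j
    rw [Finset.sum_eq_zero fun i _ => (h01 i j).resolve_right (h i)] at h0
    exact zero_ne_one h0
  choose f hf using hex
  have hinj : Function.Injective f := fun j k hjk => by
    by_contra hne
    have h0 := hm.row_mul (f j) j k
    rw [if_neg hne, hf, hjk, hf, one_mul] at h0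
    exact one_ne_zero h0
  refine ⟨Equiv.ofBijective f (Finite.injective_iff_bijective.1 hinj), hom_ext fun i j => ?_⟩
  rw [char_a, Equiv.ofBijective_apply]
  split_ifs with h
  · rw [← h, hf]
  · have h0 := hm.col_mul (f j) i j
    rw [if_neg h, hf, one_mul] at h0
    exact h0.symm

theorem char_injective : Function.Injective (char : Equiv.Perm X → QPerm X →⋆ₐ[ℂ] ℂ) := by
  intro σ τ h
  ext j
  have h1 := char_a τ (σ j) j
  rw [← h, char_a, if_pos rfl] at h1
  by_contra hne
  rw [if_neg (Ne.symm hne)] at h1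
  exact one_ne_zero h1

variable (X) in
/-- The points of the quantum permutation group are the permutations. -/
def charEquiv : Equiv.Perm X ≃ (QPerm X →⋆ₐ[ℂ] ℂ) :=
  Equiv.ofBijective char ⟨char_injective, exists_eq_char⟩

theorem isConvolution_char (σ τ : Equiv.Perm X) :
    (quantumGroup X).IsConvolution (char σ) (char τ) (char (σ * τ)) := by
  intro x
  let φ : Equiv.Perm X → core X →ₐ[ℂ] ℂ := fun σ => ((char σ).comp (core X).subtype).toAlgHom
  have h : φ (σ * τ) = (Algebra.TensorProduct.lmul' ℂ).comp
      ((Algebra.TensorProduct.map (φ σ) (φ τ)).comp (coreComul X).toAlgHom) := by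
    have hφ : ∀ σ i j, φ σ (gen i j) = if σ j = i then 1 else 0 := char_a
    refine core_hom_ext fun i j => ?_
    simp only [AlgHom.comp_apply, hφ]
    change _ = Algebra.TensorProduct.lmul' ℂ (Algebra.TensorProduct.map _ _ (coreComul X _))
    simp [coreComul_gen, hφ]
    rfl
  exact DFunLike.congr_fun h x

end QPerm

end

theorem theorem3p1 (X : Type u) [Fintype X] [DecidableEq X] :
    ∃ G : CompactQuantumGroup (QPerm X),
      (∀ i j : X, G.comul (QPerm.a i j) = ∑ k, MinTensor.tmul (QPerm.a i k) (QPerm.a k j)) ∧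
      G.core = StarAlgebra.adjoin ℂ (Set.range fun ij : X × X => QPerm.a ij.1 ij.2) ∧
      G.IsKac ∧
      ∃ (α : (X → ℂ) →⋆ₐ[ℂ] (X → ℂ) ⊗ₘ QPerm X) (hα : G.IsAction α),
        (∀ j : X, α (Pi.single j 1) =
          ∑ i, MinTensor.tmul (Pi.single i 1) (QPerm.a i j)) ∧
        QuantumTransformationGroup.IsQuantumAutomorphismGroup Set.univ ⟨QPerm X, G, α, hα⟩ ∧
        QuantumTransformationGroup.IsQuantumAutomorphismGroup
          {T : QuantumTransformationGroup (X → ℂ) | T.G.IsKac} ⟨QPerm X, G, α, hα⟩ ∧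
        {M : Matrix X X ℂ | ∃ χ : QPerm X →⋆ₐ[ℂ] ℂ, M = Matrix.of fun i j => χ (QPerm.a i j)} =
          Set.range (fun σ : Equiv.Perm X => σ.permMatrix ℂ) ∧
        ∃ F : Equiv.Perm X ≃ (QPerm X →⋆ₐ[ℂ] ℂ),
          (∀ σ i j, F σ (QPerm.a i j) = if σ j = i then 1 else 0) ∧
          ∀ σ τ, G.IsConvolution (F σ) (F τ) (F (σ * τ)) := by
  refine ⟨QPerm.quantumGroup X, QPerm.comul_a, rfl, QPerm.antipode_antipode, QPerm.action X,
    QPerm.isAction_action, QPerm.action_single,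
    ⟨trivial, fun S _ => QPerm.existsUnique_isMorphism S⟩,
    ⟨QPerm.antipode_antipode, fun S _ => QPerm.existsUnique_isMorphism S⟩, ?_,
    QPerm.charEquiv X, QPerm.char_a, QPerm.isConvolution_char⟩
  -- `Equiv.Perm.permMatrix` has its entries `1` at `(i, σ i)`, the matrix of `χ_σ` at `(σ j, j)`
  have hmat : ∀ σ : Equiv.Perm X,
      (Matrix.of fun i j => QPerm.char σ (QPerm.a i j)) = σ⁻¹.permMatrix ℂ := fun σ => by
    ext i j
    rw [Matrix.of_apply, QPerm.char_a, Equiv.Perm.permMatrix, Equiv.toPEquiv, PEquiv.toMatrix_apply]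
    refine if_congr ?_ rfl rfl
    change _ ↔ j ∈ some (σ⁻¹ i)
    rw [Option.mem_some_iff, Equiv.Perm.inv_eq_iff_eq, eq_comm]
  ext M
  constructor
  · rintro ⟨χ, rfl⟩
    obtain ⟨σ, rfl⟩ := QPerm.exists_eq_char χ
    exact ⟨σ⁻¹, (hmat σ).symm⟩
  · rintro ⟨σ, rfl⟩
    exact ⟨QPerm.char σ⁻¹, by rw [hmat, inv_inv]⟩
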